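/- For $n\in\mathbb N=\{0,1,2,\dots\}$ let $[n]=\{1,\dots,n\}$ and let $\sigma_n=2^{[n]}$ be the abstract simplex. A pointed face of $\sigma_n$ is a pair $(F,v)$ with $v\in F\subseteq[n]$. The antiprism triangulation $\mathrm{sd}_{\mathcal A}(\sigma_n)$ is the simplicial complex whose vertices are the pointed faces of $\sigma_n$ and whose faces are the sets of pairwise adjacent vertices, where distinct $(F,v)$, $(F',v')$ are adjacent if $F=F'$, or $F\subsetneq F'$ and $v'\in F'\setminus F$, or $F'\subsetneq F$ and $v\in F\setminus F'$. The carrier of a face of $\mathrm{sd}_{\mathcal A}(\sigma_n)$ is the union of the sets $F$ over its vertices $(F,v)$; for $F\subseteq[n]$ let $\Gamma_F$ be the subcomplex of faces with carrier contained in $F$. With $h(\Delta,x)=\sum_{G\in\Delta}x^{|G|}(1-x)^{d-|G|}$, where $d=\dim\Delta+1$ and the sum includes the empty face, the local $h$-polynomial is $$\ell_{\mathcal A}(\sigma_n,x)=\sum_{F\subseteq[n]}(-1)^{n-|F|}h(\Gamma_F,x).$$ An ordered set partition of a finite set $S$ is a sequence of nonempty, pairwise disjoint sets (blocks) with union $S$.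 A multi-pointed ordered set partition of $[n]$ is a pair $(\pi,\tau)$ of an ordered set partition $\pi=(B_1,\dots,B_m)$ of $[n]$ and an ordered set partition $\tau=(C_1,\dots,C_m)$ of a subset of $[n]$ with $\varnothing\ne C_i\subseteq B_i$ for all $i$; its weight is $\sum_i|C_i|$, and it is proper if $C_i\ne B_i$ for all $i$. The excedance set of a permutation $w$ of $[n]$ is $\{i: w(i)>i\}$, and a derangement is a permutation without fixed points. $S(a,b)$ denotes the Stirling numbers of the second kind. A polynomial $a_0+a_1x+\cdots+a_dx^d$ is unimodal if $a_0\le\cdots\le a_p\ge\cdots\ge a_d$ for some $p$. (a) For every $n\ge 1$, $$\ell_{\mathcal A}(\sigma_n,x)=\sum_{k=0}^{n-1}\binom nk\,\ell_{\mathcal A}(\sigma_k,x)\left((1+x)^{n-k}-1-x^{n-k}\right),$$ and $\ell_{\mathcal A}(\sigma_n,x)$ is unimodal for every $n\in\mathbb N$. (b) For all $n,k\in\mathbb N$, the coefficient of $x^k$ in $\ell_{\mathcal A}(\sigma_n,x)$ is equal to each of the following: - the number of proper multi-pointed ordered set partitions of $[n]$ of weight $k$; - the number of ways to choose an ordered set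 partition of $[n]$ and to color $k$ elements of $[n]$ black and the remaining ones white, so that no block is monochromatic; - the number of ordered set partitions $(B_1,\dots,B_m)$ of $[n]$ with $m$ even for which $\bigcup_{i=1}^{m/2}B_i$ has exactly $k$ elements; - $\binom nk$ times the number of derangements of $[n]$ with excedance set equal to $[k]$; - $\binom nk\sum_{j\ge 0}(j!)^2S(k,j)S(n-k,j)$; for $n\ge1$ this is also equal to $\binom nk\sum_{j\ge 1}(j!)^2S(k,j)S(n-k,j)$. (Both quantities that contain the factor $\binom nk$ are read as $0$ when $k>n$.) -/

import Mathlib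

open Polynomial Finset

namespace Antiprism

noncomputable section

/-! ### Simplicial complexes, `h`-polynomials and local `h`-polynomials

Mathlib's simplicial complexes list only the nonempty faces; the empty set, which is a face of every
simplicial complex in the convention used here, is added by `allFaces`. -/

section Complexes

variable {W V : Type*}

open Classical in
/-- All faces of a finite simplicial complex, including the empty face. -/
def allFaces [Fintype W] (Γ : PreAbstractSimplicialComplex W) : Finset (Finset W) :=
  univ.filter fun G => G = ∅ ∨ G ∈ Γ

/-- `dim Γ + 1`, the maximal cardinality of a face. -/
def rank [Fintype W] (Γ : PreAbstractSimplicialComplex W) : ℕ :=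
  (allFaces Γ).sup Finset.card

/-- The `h`-polynomial `h(Γ, x) = ∑_{G ∈ Γ} x^|G| (1 - x)^(d - |G|)`, where `d = dim Γ + 1`. -/
def hPoly [Fintype W] (Γ : PreAbstractSimplicialComplex W) : ℤ[X] :=
  ∑ G ∈ allFaces Γ, X ^ G.card * (1 - X) ^ (rank Γ - G.card)

/-- Let `Γ` be a triangulation of the simplex `2^V` and let `c w` be the carrier of the vertex `w`
of `Γ`. The carrier of a face of `Γ` is then the union of the carriers of its vertices. This is the
restriction `Γ_F` of `Γ` to the face `F` of `2^V`: the faces of `Γ` with carrier inside `F`. -/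
def restriction (Γ : PreAbstractSimplicialComplex W) (c : W → Finset V) (F : Finset V) :
    PreAbstractSimplicialComplex W where
  faces := {G | G ∈ Γ ∧ ∀ w ∈ G, c w ⊆ F}
  isRelLowerSet_faces := by
    rintro G ⟨hG, hF⟩
    refine ⟨(Γ.isRelLowerSet_faces hG).1, fun H hHG hH => ⟨?_, fun w hw => hF w (hHG hw)⟩⟩
    exact (Γ.isRelLowerSet_faces hG).2 hHG hH

/-- The local `h`-polynomial `ℓ_V(Γ, x) = ∑_{F ⊆ V} (-1)^(|V| - |F|) h(Γ_F, x)` of a triangulation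
`Γ` of the simplex `2^V` whose vertices have carriers given by `c`. -/
def localHPoly [Fintype W] [Fintype V] (Γ : PreAbstractSimplicialComplex W) (c : W → Finset V) :
    ℤ[X] :=
  ∑ F : Finset V, (-1) ^ (Fintype.card V - F.card) * hPoly (restriction Γ c F)

end Complexes

/-! ### The antiprism triangulation -/

section AntiprismTriangulation

variable {V : Type*}

/-- A pointed face `(F, v)` of a simplicial complex: a face `F` and a vertex `v ∈ F`. -/
@[ext]
structure PointedFace (Δ : PreAbstractSimplicialComplex V) where
  face : Finset V
  point : V
  face_mem : face ∈ Δ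
  point_mem : point ∈ face

instance [Finite V] (Δ : PreAbstractSimplicialComplex V) : Finite (PointedFace Δ) :=
  Finite.of_injective (fun p : PointedFace Δ => (p.face, p.point)) fun p q h => by
    simp only [Prod.mk.injEq] at h
    exact PointedFace.ext h.1 h.2

instance [Finite V] (Δ : PreAbstractSimplicialComplex V) : Fintype (PointedFace Δ) :=
  Fintype.ofFinite _

/-- The graph on the pointed faces of `Δ`: distinct pointed faces `(F, v)` and `(F', v')` are
adjacent if `F = F'`, or `F ⊊ F'` and `v' ∈ F' \ F`, or `F' ⊊ F` and `v ∈ F \ F'`. -/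
def pointedFaceGraph (Δ : PreAbstractSimplicialComplex V) : SimpleGraph (PointedFace Δ) where
  Adj p q := p ≠ q ∧ (p.face = q.face ∨
    (p.face ⊂ q.face ∧ q.point ∈ q.face ∧ q.point ∉ p.face) ∨
    (q.face ⊂ p.face ∧ p.point ∈ p.face ∧ p.point ∉ q.face))
  symm := ⟨fun p q h => ⟨h.1.symm, by
    rcases h.2 with h | h | h
    · exact Or.inl h.symm
    · exact Or.inr (Or.inr h)
    · exact Or.inr (Or.inl h)⟩⟩
  loopless := ⟨fun _ h => h.1 rfl⟩

/-- The clique complex of a graph. -/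
def cliqueComplex {W : Type*} (G : SimpleGraph W) : PreAbstractSimplicialComplex W where
  faces := {s | s.Nonempty ∧ G.IsClique (s : Set W)}
  isRelLowerSet_faces := fun {_} h =>
    ⟨h.1, fun _ hts ht => ⟨ht, Set.Pairwise.mono (Finset.coe_subset.mpr hts) h.2⟩⟩

/-- The antiprism triangulation of `Δ`. -/
def antiprismTriangulation (Δ : PreAbstractSimplicialComplex V) :
    PreAbstractSimplicialComplex (PointedFace Δ) :=
  cliqueComplex (pointedFaceGraph Δ)

/-- The simplex `σ_n = 2^[n]`; all nonempty subsets of the vertex set are faces. -/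
def simplex (n : ℕ) : PreAbstractSimplicialComplex (Fin n) := ⊤

/-- The local `h`-polynomial `ℓ_A(σ_n, x)` of the antiprism triangulation of `σ_n`. The carrier of
the vertex `(F, v)` is `F`. -/
def ellA (n : ℕ) : ℤ[X] :=
  localHPoly (antiprismTriangulation (simplex n)) PointedFace.face

end AntiprismTriangulation

/-! ### Combinatorial objects -/

/-- A polynomial `a_0 + a_1 x + ⋯ + a_d x^d` is unimodal if `a_0 ≤ ⋯ ≤ a_k ≥ ⋯ ≥ a_d` for some
`k`. -/
def IsUnimodal {R : Type*} [Semiring R] [Preorder R] (p : R[X]) : Prop :=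
  ∃ k ≤ p.natDegree, MonotoneOn p.coeff (Set.Icc 0 k) ∧
    AntitoneOn p.coeff (Set.Icc k p.natDegree)

/-- The union of a sequence of finite sets. -/
def blockUnion {α : Type*} [DecidableEq α] (π : List (Finset α)) : Finset α :=
  π.foldr (fun B U => B ∪ U) ∅

/-- `π` is an ordered partition of `S`: a sequence of nonempty, pairwise disjoint sets with
union `S`. -/
def IsOrderedPartition {α : Type*} [DecidableEq α] (S : Finset α) (π : List (Finset α)) : Prop :=
  (∀ B ∈ π, B.Nonempty) ∧ π.Pairwise Disjoint ∧ blockUnion π = S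

/-- `(π, τ)` is a multi-pointed ordered partition of `S`: `π = (B_1, …, B_m)` and
`τ = (C_1, …, C_m)` are ordered partitions of `S` and of a subset of `S`, respectively, with the
same number of blocks, and `C_i ⊆ B_i` for every `i`. -/
def IsMultiPointedOrderedPartition {α : Type*} [DecidableEq α] (S : Finset α)
    (π τ : List (Finset α)) : Prop :=
  IsOrderedPartition S π ∧ (∃ T ⊆ S, IsOrderedPartition T τ) ∧
    List.Forall₂ (fun B C => C ⊆ B) π τ

/-- `(π, τ)` is proper if `C_i` is different from `B_i` for every `i`. -/
def IsProper {α : Type*} (π τ : List (Finset α)) : Prop :=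
  List.Forall₂ (fun B C => C ≠ B) π τ

/-- The weight of `(π, τ)`: the total number of chosen elements. -/
def weight {α : Type*} (τ : List (Finset α)) : ℕ :=
  (τ.map Finset.card).sum

/-- The proper multi-pointed ordered partitions of `[n]` of weight `k`. -/
def properMultiPointed (n k : ℕ) : Set (List (Finset (Fin n)) × List (Finset (Fin n))) :=
  {φ | IsMultiPointedOrderedPartition univ φ.1 φ.2 ∧ IsProper φ.1 φ.2 ∧ weight φ.2 = k}

/-- A set `B` is monochromatic if all its elements have the same color. -/
def IsMonochromatic {α : Type*} (c : α → Bool) (B : Finset α) : Prop :=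
  ∃ b : Bool, ∀ x ∈ B, c x = b

/-- Pairs of an ordered partition of `[n]` and a coloring of `[n]` with `k` black elements
(color `true`) and the others white (color `false`), such that no block is monochromatic. -/
def coloredPartitions (n k : ℕ) : Set (List (Finset (Fin n)) × (Fin n → Bool)) :=
  {φ | IsOrderedPartition univ φ.1 ∧ (univ.filter fun x => φ.2 x = true).card = k ∧
    ∀ B ∈ φ.1, ¬ IsMonochromatic φ.2 B}

/-- The ordered partitions `(B_1, …, B_m)` of `[n]` with `m` even for which
`B_1 ∪ ⋯ ∪ B_{m/2}` has `k` elements. -/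
def evenPartitions (n k : ℕ) : Set (List (Finset (Fin n))) :=
  {π | IsOrderedPartition univ π ∧ Even π.length ∧
    (blockUnion (π.take (π.length / 2))).card = k}

/-- The excedance set `{i : w(i) > i}` of a permutation. (The index `n` of `[n]` is never an
excedance.) -/
def excedanceSet {n : ℕ} (w : Equiv.Perm (Fin n)) : Finset (Fin n) :=
  univ.filter fun i => i < w i

/-- The derangements of `[n]` with excedance set `[k]`. The element `i` of `Fin n` stands for the
element `i + 1` of `[n]`, so that `[k]` is the set of all `i` with `i < k`. -/
def derangementsWithExcedanceSet (n k : ℕ) : Set (Equiv.Perm (Fin n)) :=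
  {w | w ∈ derangements (Fin n) ∧ excedanceSet w = univ.filter fun i : Fin n => (i : ℕ) < k}

end

end Antiprism

/-! The whole statement follows from one generating function, $\sum_n\ell_{\mathcal
A}(\sigma_n,x)z^n/n!=1/(1-(e^{xz}-1)(e^z-1))$ (`egf_ellQ`).

To obtain it, sort the faces of the triangulation by carrier. The vertices of a face have comparable
underlying sets, so those with the largest one, $S$, form a top layer. Removing this layer leaves a
face with carrier $T\subsetneq S$, and the layer itself is any nonempty subset of $S\setminus T$
(`carrierPoly_eq`). This recursion determines the generating function $q$ of the contributions by
carrier: $q\,(1-e^z+e^{(1-x)z})=1$. Passing to $h$-polynomials multiplies by $e^{(1-x)z}$, and the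
alternating sum in the local $h$-polynomial multiplies by $e^{-z}$.

Clearing the denominator gives the recurrence of (a). Its kernel $(1+x)^m-1-x^m$ lies in a cone of
symmetric unimodal polynomials closed under multiplication (`mul_mem_unimodalCone`), so unimodality
follows by induction.

Expanding the geometric series gives the Stirling formula (`coeff_ellA`), since $(e^z-1)^j$ counts
ordered partitions into $j$ blocks. The three families of ordered partitions are in bijection with
pairs of equally long ordered partitions of complementary sets (`ncard_partitionPairs`). A
derangement with excedance set $[k]$ splits into two rook placements on staircase boards, counted by
Stirling numbers (`sum_rookPlacements`), and two bijections between their free rows and columns,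
which give the factor $(j!)^2$ (`card_perm_parts`). -/

namespace Antiprism

noncomputable section

/-! ### Faces of the antiprism triangulation, sorted by carrier. -/

section Cliques

variable {V : Type*}

/-- The pointed faces of the simplex on `V`. -/
abbrev PFace (V : Type*) := PointedFace (⊤ : PreAbstractSimplicialComplex V)

theorem mem_top_iff {F : Finset V} :
    F ∈ (⊤ : PreAbstractSimplicialComplex V) ↔ F.Nonempty := Iff.rfl

/-- The pointed face `(F, v)` of the simplex. -/
def PFace.mk {F : Finset V} (v : V) (hv : v ∈ F) : PFace V :=
  ⟨F, v, mem_top_iff.2 ⟨v, hv⟩, hv⟩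

/-- The property of being a face (possibly empty) of the antiprism triangulation. -/
def IsFace (G : Finset (PFace V)) : Prop :=
  (pointedFaceGraph (⊤ : PreAbstractSimplicialComplex V)).IsClique (G : Set (PFace V))

theorem IsFace.mono {G H : Finset (PFace V)} (hG : IsFace G) (h : H ⊆ G) : IsFace H :=
  Set.Pairwise.mono (coe_subset.mpr h) hG

theorem isFace_empty : IsFace (∅ : Finset (PFace V)) := by
  simp [IsFace]

/-- Of two adjacent vertices with different underlying sets, the larger one has its point outside
the smaller set, so the points cannot agree. -/
theorem IsFace.injOn_point {G : Finset (PFace V)} (hG : IsFace G) :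
    Set.InjOn PointedFace.point (G : Set (PFace V)) := by
  intro p hp q hq h
  by_contra hne
  rcases (hG hp hq hne).2 with h' | ⟨_, _, h'⟩ | ⟨_, _, h'⟩
  · exact hne (PointedFace.ext h' h)
  · exact h' (h ▸ p.point_mem)
  · exact h' (h ▸ q.point_mem)

variable [DecidableEq V]

/-- The carrier of a set of pointed faces. -/
def carrier (G : Finset (PFace V)) : Finset V := G.biUnion PointedFace.face

theorem face_subset_carrier {G : Finset (PFace V)} {w : PFace V} (hw : w ∈ G) :
    w.face ⊆ carrier G := subset_biUnion_of_mem PointedFace.face hw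

theorem carrier_subset_iff {G : Finset (PFace V)} {F : Finset V} :
    carrier G ⊆ F ↔ ∀ w ∈ G, w.face ⊆ F := biUnion_subset

/-- The points of a face are distinct elements of its carrier. This bound keeps the natural
subtractions in the exponents of `1 - X` from truncating. -/
theorem IsFace.card_le {G : Finset (PFace V)} (hG : IsFace G) : #G ≤ #(carrier G) :=
  card_le_card_of_injOn PointedFace.point
    (fun _ hw => face_subset_carrier hw (PointedFace.point_mem _)) hG.injOn_point

/-- A nonempty face of the antiprism triangulation has a vertex with the same carrier. -/
theorem IsFace.exists_face_eq_carrier {G : Finset (PFace V)} (hG : IsFace G)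
    (hne : G.Nonempty) : ∃ w ∈ G, w.face = carrier G := by
  -- Adjacent vertices have comparable underlying sets, so one of maximal cardinality contains all
  -- the others.
  obtain ⟨w, hw, hmax⟩ := exists_max_image G (fun w => #w.face) hne
  refine ⟨w, hw, (face_subset_carrier hw).antisymm (carrier_subset_iff.2 fun p hp => ?_)⟩
  by_cases hpw : p = w
  · rw [hpw]
  rcases (hG hp hw hpw).2 with h | ⟨h, _⟩ | ⟨h, _⟩
  · exact h.subset
  · exact h.subset
  · exact absurd (hmax p hp) (not_le.2 (card_lt_card h))

variable [Fintype V]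

open Classical in
theorem allFaces_restriction (F : Finset V) :
    allFaces (restriction (antiprismTriangulation (⊤ : PreAbstractSimplicialComplex V))
      PointedFace.face F) = univ.filter fun G => IsFace G ∧ carrier G ⊆ F := by
  ext G
  simp only [allFaces, mem_filter, mem_univ, true_and, carrier_subset_iff]
  constructor
  · rintro (rfl | ⟨⟨_, h1⟩, h2⟩)
    · exact ⟨isFace_empty, by simp⟩
    · exact ⟨h1, h2⟩
  · rintro ⟨h1, h2⟩
    rcases G.eq_empty_or_nonempty with rfl | hG
    · exact Or.inl rfl
    · exact Or.inr ⟨⟨hG, h1⟩, h2⟩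

open Classical in
/-- The vertices `(F, v)` with `v ∈ C`. -/
def layer (F C : Finset V) : Finset (PFace V) :=
  univ.filter fun w => w.face = F ∧ w.point ∈ C

theorem mem_layer {F C : Finset V} {w : PFace V} :
    w ∈ layer F C ↔ w.face = F ∧ w.point ∈ C := by
  classical simp [layer]

theorem card_layer {F C : Finset V} (h : C ⊆ F) : #(layer F C) = #C := by
  refine card_bij (fun w _ => w.point) (fun w hw => (mem_layer.1 hw).2) ?_ ?_
  · intro p hp q hq h
    exact PointedFace.ext ((mem_layer.1 hp).1.trans (mem_layer.1 hq).1.symm) h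
  · intro v hv
    exact ⟨PFace.mk v (h hv), mem_layer.2 ⟨rfl, hv⟩, rfl⟩

theorem isFace_layer (F C : Finset V) : IsFace (layer F C) := by
  intro p hp q hq hne
  exact ⟨hne, Or.inl ((mem_layer.1 hp).1.trans (mem_layer.1 hq).1.symm)⟩

/-- The bound `IsFace.card_le` is attained by the vertices `(F, v)` with `v ∈ F`, which form a
clique. -/
theorem rank_restriction (F : Finset V) :
    rank (restriction (antiprismTriangulation (⊤ : PreAbstractSimplicialComplex V))
      PointedFace.face F) = #F := by
  classical
  rw [rank, allFaces_restriction]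
  apply le_antisymm
  · refine Finset.sup_le fun G hG => ?_
    simp only [mem_filter, mem_univ, true_and] at hG
    exact hG.1.card_le.trans (card_le_card hG.2)
  · rw [← card_layer (Subset.refl F)]
    refine le_sup (f := Finset.card) ?_
    simp only [mem_filter, mem_univ, true_and]
    exact ⟨isFace_layer F F, carrier_subset_iff.2 fun w hw => (mem_layer.1 hw).1.subset⟩

open Classical in
/-- The contribution to the `h`-polynomial of the faces with carrier `S`. -/
def carrierPoly (S : Finset V) : ℤ[X] :=
  ∑ G : Finset (PFace V) with IsFace G ∧ carrier G = S, X ^ #G * (1 - X) ^ (#S - #G)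

theorem hPoly_restriction (F : Finset V) :
    hPoly (restriction (antiprismTriangulation (⊤ : PreAbstractSimplicialComplex V))
      PointedFace.face F) = ∑ S ∈ F.powerset, (1 - X) ^ (#F - #S) * carrierPoly S := by
  classical
  rw [hPoly, allFaces_restriction, rank_restriction,
    ← sum_fiberwise_of_maps_to (t := F.powerset) (g := carrier)]
  · refine sum_congr rfl fun S hS => ?_
    rw [carrierPoly, mul_sum, filter_filter]
    have hSF := mem_powerset.1 hS
    refine sum_congr ?_ fun G hG => ?_
    · ext G
      simp only [mem_filter, mem_univ, true_and]
      constructor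
      · rintro ⟨⟨h1, _⟩, h2⟩
        exact ⟨h1, h2⟩
      · rintro ⟨h1, h2⟩
        exact ⟨⟨h1, h2 ▸ hSF⟩, h2⟩
    · simp only [mem_filter, mem_univ, true_and] at hG
      have h1 := hG.1.card_le
      rw [hG.2] at h1
      have h2 := card_le_card hSF
      rw [show #F - #G = (#F - #S) + (#S - #G) by omega, pow_add]
      ring
  · intro G hG
    simp only [mem_filter, mem_univ, true_and] at hG
    exact mem_powerset.2 hG.2

theorem carrierPoly_empty : carrierPoly (∅ : Finset V) = 1 := by
  classical
  have : (univ.filter fun G : Finset (PFace V) => IsFace G ∧ carrier G = ∅) = {∅} := by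
    ext G
    simp only [mem_filter, mem_univ, true_and, mem_singleton]
    constructor
    · rintro ⟨h1, h2⟩
      have := h1.card_le
      rw [h2] at this
      simpa using this
    · rintro rfl
      exact ⟨isFace_empty, rfl⟩
  rw [carrierPoly, this]
  simp

/-- The binomial theorem for `X + (1 - X) = 1`, without the empty set. This is the total
contribution of all possible top layers with points in `R`. -/
theorem sum_powerset_erase_empty {α : Type*} [DecidableEq α] (R : Finset α) :
    ∑ C ∈ R.powerset.erase ∅, (X : ℤ[X]) ^ #C * (1 - X) ^ (#R - #C) = 1 - (1 - X) ^ #R := by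
  have h := Finset.sum_pow_mul_eq_add_pow (X : ℤ[X]) (1 - X) R
  rw [← add_sum_erase _ _ (empty_mem_powerset R)] at h
  simp only [card_empty, pow_zero, Nat.sub_zero, one_mul] at h
  rw [add_sub_cancel, one_pow] at h
  exact eq_sub_of_add_eq' h

open Classical in
/-- Removing from a face all vertices of maximal carrier. -/
theorem carrierPoly_eq {S : Finset V} (hS : S.Nonempty) :
    carrierPoly S = ∑ T ∈ S.ssubsets, carrierPoly T * (1 - (1 - X) ^ (#S - #T)) := by
  have key : ∀ T ∈ S.ssubsets, carrierPoly T * (1 - (1 - X : ℤ[X]) ^ (#S - #T)) =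
      ∑ p ∈ (univ.filter fun G : Finset (PFace V) => IsFace G ∧ carrier G = T) ×ˢ
        ((S \ T).powerset.erase ∅),
        X ^ (#p.1 + #p.2) * (1 - X) ^ (#S - (#p.1 + #p.2)) := by
    intro T hT
    have hTS := (mem_ssubsets.1 hT).subset
    rw [← card_sdiff_of_subset hTS, ← sum_powerset_erase_empty, carrierPoly, sum_mul_sum,
      sum_product]
    refine sum_congr rfl fun G hG => sum_congr rfl fun C hC => ?_
    simp only [mem_filter, mem_univ, true_and] at hG
    have h1 := hG.1.card_le
    rw [hG.2] at h1
    have h2 := card_le_card (mem_powerset.1 (mem_of_mem_erase hC))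
    have h3 := card_le_card hTS
    rw [card_sdiff_of_subset hTS] at *
    rw [show #S - (#G + #C) = (#T - #G) + (#S - #T - #C) by omega, pow_add, pow_add]
    ring
  rw [sum_congr rfl key, sum_sigma', carrierPoly]
  symm
  -- A face corresponds to the carrier `T` of its lower part, that lower part, and the set `C` of
  -- points of its top layer.
  refine sum_bij' (fun q _ => q.2.1 ∪ layer S q.2.2)
    (fun G _ => ⟨carrier (G.filter fun w => w.face ≠ S), (G.filter fun w => w.face ≠ S,
      (G.filter fun w => w.face = S).image PointedFace.point)⟩) ?_ ?_ ?_ ?_ ?_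
  · rintro ⟨T, G, C⟩ h
    simp only [mem_sigma, mem_ssubsets, mem_product, mem_filter, mem_univ, true_and, mem_erase,
      mem_powerset] at h ⊢
    obtain ⟨hT, ⟨hG, hGT⟩, hC, hCS⟩ := h
    have hadj : ∀ p ∈ G, ∀ q ∈ layer S C, p.face ⊂ q.face ∧ q.point ∉ p.face := by
      intro p hp q hq
      have hq := mem_layer.1 hq
      have hpT : p.face ⊆ T := hGT ▸ face_subset_carrier hp
      exact ⟨hq.1 ▸ lt_of_le_of_lt hpT hT, fun h => (mem_sdiff.1 (hCS hq.2)).2 (hpT h)⟩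
    constructor
    · intro p hp q hq hne
      simp only [coe_union, Set.mem_union, mem_coe] at hp hq
      rcases hp with hp | hp <;> rcases hq with hq | hq
      · exact hG hp hq hne
      · exact ⟨hne, Or.inr (Or.inl ⟨(hadj p hp q hq).1, q.point_mem, (hadj p hp q hq).2⟩)⟩
      · exact ⟨hne, Or.inr (Or.inr ⟨(hadj q hq p hp).1, p.point_mem, (hadj q hq p hp).2⟩)⟩
      · exact isFace_layer S C hp hq hne
    · apply Subset.antisymm
      · refine carrier_subset_iff.2 fun w hw => ?_
        rcases mem_union.1 hw with hw | hw
        · exact (hGT ▸ face_subset_carrier hw : w.face ⊆ T).trans hT.subset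
        · exact (mem_layer.1 hw).1.subset
      · obtain ⟨v, hv⟩ := nonempty_iff_ne_empty.2 hC
        exact face_subset_carrier (w := PFace.mk v (sdiff_subset (hCS hv)))
          (mem_union_right _ (mem_layer.2 ⟨rfl, hv⟩))
  · intro G h
    simp only [mem_sigma, mem_ssubsets, mem_product, mem_filter, mem_univ, true_and, mem_erase,
      mem_powerset] at h ⊢
    obtain ⟨hG, hGS⟩ := h
    have hGne : G.Nonempty := by
      rw [nonempty_iff_ne_empty]
      rintro rfl
      rw [← hGS] at hS
      exact hS.ne_empty rfl
    obtain ⟨w, hw, hwS⟩ := hG.exists_face_eq_carrier hGne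
    rw [hGS] at hwS
    -- The point of a top vertex avoids the underlying set of every lower vertex. This yields both
    -- `T ≠ S` and `C ⊆ S \ T`.
    have hpt : ∀ q ∈ G, q.face = S → q.point ∉ carrier (G.filter fun w => w.face ≠ S) := by
      intro q hq hqS hmem
      obtain ⟨p, hp, hpq⟩ := mem_biUnion.1 hmem
      obtain ⟨hp, hpS⟩ := mem_filter.1 hp
      rcases (hG hp hq (by rintro rfl; exact hpS hqS)).2 with h | ⟨_, _, h⟩ | ⟨h, _⟩
      · exact hpS (h.trans hqS)
      · exact h hpq
      · exact (hqS ▸ h).not_subset (hGS ▸ face_subset_carrier hp)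
    have hsub : carrier (G.filter fun w => w.face ≠ S) ⊆ S :=
      carrier_subset_iff.2 fun p hp => hGS ▸ face_subset_carrier (mem_filter.1 hp).1
    refine ⟨?_, ⟨hG.mono (filter_subset _ _), trivial⟩, ?_, ?_⟩
    · refine hsub.ssubset_of_ne fun h => hpt w hw hwS ?_
      rw [h, ← hwS]
      exact w.point_mem
    · rw [← nonempty_iff_ne_empty]
      exact ⟨w.point, mem_image_of_mem _ (mem_filter.2 ⟨hw, hwS⟩)⟩
    · intro v hv
      obtain ⟨q, hq, rfl⟩ := mem_image.1 hv
      obtain ⟨hq, hqS⟩ := mem_filter.1 hq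
      exact mem_sdiff.2 ⟨hqS ▸ q.point_mem, hpt q hq hqS⟩
  · rintro ⟨T, G, C⟩ h
    simp only [mem_sigma, mem_ssubsets, mem_product, mem_filter, mem_univ, true_and, mem_erase,
      mem_powerset] at h
    obtain ⟨hT, ⟨hG, hGT⟩, hC, hCS⟩ := h
    have hne : ∀ w ∈ G, w.face ≠ S := fun w hw h =>
      hT.not_subset (h ▸ hGT ▸ face_subset_carrier hw)
    have h1 : ((G ∪ layer S C).filter fun w => w.face ≠ S) = G := by
      ext w
      simp only [mem_filter, mem_union, mem_layer]
      have := hne w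
      tauto
    have h2 : ((G ∪ layer S C).filter fun w => w.face = S).image PointedFace.point = C := by
      ext v
      simp only [mem_image, mem_filter, mem_union, mem_layer]
      constructor
      · rintro ⟨w, ⟨hw | hw, hwS⟩, rfl⟩
        · exact absurd hwS (hne w hw)
        · exact hw.2
      · intro hv
        exact ⟨PFace.mk v (sdiff_subset (hCS hv)), ⟨Or.inr ⟨rfl, hv⟩, rfl⟩, rfl⟩
    simp only [h1, h2, hGT]
  · intro G h
    simp only [mem_filter, mem_univ, true_and] at h
    ext w
    simp only [mem_filter, mem_union, mem_layer, mem_image]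
    constructor
    · rintro (hw | ⟨hw, q, ⟨hq, hqS⟩, hqw⟩)
      · exact hw.1
      · rwa [← PointedFace.ext (hqS.trans hw.symm) hqw]
    · intro hw
      by_cases hwS : w.face = S
      · exact Or.inr ⟨hwS, w, ⟨hw, hwS⟩, rfl⟩
      · exact Or.inl ⟨hw, hwS⟩
  · rintro ⟨T, G, C⟩ h
    simp only [mem_sigma, mem_ssubsets, mem_product, mem_filter, mem_univ, true_and, mem_erase,
      mem_powerset] at h
    obtain ⟨hT, ⟨hG, hGT⟩, hC, hCS⟩ := h
    have hdisj : Disjoint G (layer S C) := by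
      rw [disjoint_left]
      intro w hw hw'
      exact hT.not_subset ((mem_layer.1 hw').1 ▸ hGT ▸ face_subset_carrier hw)
    rw [card_union_of_disjoint hdisj, card_layer (hCS.trans sdiff_subset)]

end Cliques

/-! ### Exponential generating functions and Stirling numbers. -/

section ExponentialGeneratingFunctions

variable {K : Type*} [CommRing K] [Algebra ℚ K]

/-- The exponential generating function of a sequence. -/
def egf (f : ℕ → K) : PowerSeries K :=
  PowerSeries.mk fun n => algebraMap ℚ K (1 / (n.factorial : ℚ)) * f n

theorem coeff_egf (f : ℕ → K) (n : ℕ) :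
    PowerSeries.coeff n (egf f) = algebraMap ℚ K (1 / (n.factorial : ℚ)) * f n :=
  PowerSeries.coeff_mk _ _

/-- Division by `n!` goes through `ℚ`, because the coefficient ring `ℚ[X]` used below is not a
field. This lemma undoes it. -/
theorem factorial_mul_coeff_egf (f : ℕ → K) (n : ℕ) :
    (n.factorial : K) * PowerSeries.coeff n (egf f) = f n := by
  have h : (n.factorial : K) = algebraMap ℚ K (n.factorial : ℚ) := (map_natCast _ _).symm
  rw [coeff_egf, h, ← mul_assoc, ← map_mul, mul_one_div_cancel (by positivity), map_one, one_mul]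

theorem egf_injective : Function.Injective (egf : (ℕ → K) → PowerSeries K) := by
  intro f g h
  ext n
  rw [← factorial_mul_coeff_egf f, h, factorial_mul_coeff_egf]

theorem egf_eq_of_forall_coeff {f : ℕ → K} {p : PowerSeries K}
    (h : ∀ n, (n.factorial : K) * PowerSeries.coeff n p = f n) : egf f = p := by
  ext n
  have h' : (n.factorial : K) = algebraMap ℚ K (n.factorial : ℚ) := (map_natCast _ _).symm
  rw [coeff_egf, ← h, h', ← mul_assoc, ← map_mul, one_div_mul_cancel (by positivity), map_one,
    one_mul]

theorem egf_mul (f g : ℕ → K) :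
    egf f * egf g = egf fun n => ∑ k ∈ range (n + 1), (n.choose k : K) * f k * g (n - k) := by
  ext n
  rw [PowerSeries.coeff_mul, Finset.Nat.sum_antidiagonal_eq_sum_range_succ_mk, coeff_egf, mul_sum]
  refine sum_congr rfl fun k hk => ?_
  have hk : k ≤ n := Nat.lt_succ_iff.1 (mem_range.1 hk)
  rw [coeff_egf, coeff_egf]
  have h : (n.choose k : K) = algebraMap ℚ K (n.choose k : ℚ) := (map_natCast _ _).symm
  have h2 : (1 / (k.factorial : ℚ)) * (1 / ((n - k).factorial : ℚ)) =
      1 / (n.factorial : ℚ) * (n.choose k : ℚ) := by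
    rw [Nat.cast_choose ℚ hk]
    have := Nat.factorial_ne_zero n
    field_simp
  calc _ = algebraMap ℚ K ((1 / (k.factorial : ℚ)) * (1 / ((n - k).factorial : ℚ))) *
        (f k * g (n - k)) := by rw [map_mul]; ring
    _ = _ := by rw [h2, map_mul, h]; ring

theorem egf_add (f g : ℕ → K) : egf (fun n => f n + g n) = egf f + egf g := by
  ext n
  simp only [coeff_egf, map_add, mul_add]

theorem egf_sub (f g : ℕ → K) : egf (fun n => f n - g n) = egf f - egf g := by
  ext n
  simp only [coeff_egf, map_sub, mul_sub]

theorem egf_sum {ι : Type*} (s : Finset ι) (f : ι → ℕ → K) :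
    egf (fun n => ∑ i ∈ s, f i n) = ∑ i ∈ s, egf (f i) := by
  ext n
  simp only [coeff_egf, map_sum, mul_sum]

theorem egf_ite : egf (fun n => if n = 0 then (1 : K) else 0) = 1 := by
  ext n
  rw [coeff_egf, PowerSeries.coeff_one]
  split_ifs with h
  · simp [h]
  · simp

theorem rescale_egf (x : K) (f : ℕ → K) :
    PowerSeries.rescale x (egf f) = egf fun n => x ^ n * f n := by
  ext n
  rw [PowerSeries.coeff_rescale, coeff_egf, coeff_egf]
  ring

/-- The exponential power series `e^(xz)`. -/
def expSeries (x : K) : PowerSeries K := egf fun n => x ^ n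

theorem expSeries_zero : expSeries (0 : K) = 1 := by
  rw [← egf_ite, expSeries]
  congr 1
  ext n
  rw [zero_pow_eq]

theorem expSeries_mul (x y : K) : expSeries x * expSeries y = expSeries (x + y) := by
  rw [expSeries, expSeries, expSeries, egf_mul]
  congr 1
  ext n
  rw [add_pow]
  exact sum_congr rfl fun k _ => by ring

theorem rescale_expSeries (x y : K) :
    PowerSeries.rescale x (expSeries y) = expSeries (x * y) := by
  rw [expSeries, rescale_egf, expSeries]
  congr 1
  ext n
  rw [mul_pow]

theorem constantCoeff_expSeries (x : K) : PowerSeries.constantCoeff (expSeries x) = 1 := by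
  rw [← PowerSeries.coeff_zero_eq_constantCoeff_apply, expSeries, coeff_egf]
  simp

theorem derivative_expSeries_one :
    PowerSeries.derivative K (expSeries (1 : K)) = expSeries 1 := by
  ext n
  rw [PowerSeries.coeff_derivative, expSeries, coeff_egf, coeff_egf]
  have h : ((n : K) + 1) = algebraMap ℚ K ((n : ℚ) + 1) := by simp
  rw [one_pow, one_pow, mul_one, mul_one, h, ← map_mul]
  congr 1
  rw [Nat.factorial_succ]
  push_cast
  field_simp

/-- The number of ordered partitions of an `n`-element set into `j` blocks. -/
def ordStirling (j n : ℕ) : ℕ := j.factorial * n.stirlingSecond j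

/-- With $E=e^z$, the derivative of $(E-1)^{j+1}$ is $(j+1)\left((E-1)^{j+1}+(E-1)^j\right)$, which
is the Stirling recurrence multiplied by $(j+1)!$. -/
theorem egf_ordStirling (j : ℕ) :
    egf (fun n => (ordStirling j n : K)) = (expSeries 1 - 1) ^ j := by
  refine egf_eq_of_forall_coeff fun n => ?_
  induction n generalizing j with
  | zero =>
    rw [PowerSeries.coeff_zero_eq_constantCoeff_apply, map_pow, map_sub, map_one,
      constantCoeff_expSeries, sub_self]
    cases j <;> simp [ordStirling]
  | succ n ih =>
    cases j with
    | zero => simp [ordStirling, PowerSeries.coeff_one]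
    | succ j =>
      have hd : PowerSeries.derivative K ((expSeries (1 : K) - 1) ^ (j + 1)) =
          (j + 1 : ℕ) • ((expSeries 1 - 1) ^ (j + 1) + (expSeries 1 - 1) ^ j) := by
        rw [Derivation.leibniz_pow, map_sub, derivative_expSeries_one, Derivation.map_one_eq_zero]
        simp only [add_tsub_cancel_right, sub_zero, smul_eq_mul, nsmul_eq_mul]
        ring
      have hc := congrArg (PowerSeries.coeff n) hd
      rw [PowerSeries.coeff_derivative] at hc
      rw [Nat.factorial_succ, Nat.cast_mul, mul_comm ((n + 1 : ℕ) : K), mul_assoc,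
        mul_comm ((n + 1 : ℕ) : K), Nat.cast_succ, hc, map_nsmul, map_add, nsmul_eq_mul,
        mul_left_comm, mul_add, ih, ih]
      simp only [ordStirling, Nat.stirlingSecond_succ_succ, Nat.factorial_succ]
      push_cast
      ring

/-- Compares coefficients in $(E-1)^{j+1}=(E-1)^j(E-1)$. Combinatorially, `m` is the number of
elements left after removing one block, and `m = n` is excluded because blocks are nonempty. -/
theorem ordStirling_succ (j n : ℕ) :
    ordStirling (j + 1) n = ∑ m ∈ range n, n.choose m * ordStirling j m := by
  have h : egf (fun n => (ordStirling (j + 1) n : ℚ)) = egf (fun n => (ordStirling j n : ℚ)) *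
      egf (fun n => (1 : ℚ) ^ n - if n = 0 then 1 else 0) := by
    rw [egf_sub, egf_ite, egf_ordStirling, egf_ordStirling, pow_succ, expSeries]
  rw [egf_mul] at h
  have h := congrFun (egf_injective h) n
  rw [sum_range_succ, Nat.sub_self, pow_zero, if_pos rfl, sub_self, mul_zero, add_zero] at h
  rw [← Nat.cast_inj (R := ℚ), h, Nat.cast_sum]
  refine sum_congr rfl fun k hk => ?_
  rw [if_neg (by have := mem_range.1 hk; omega)]
  simp

end ExponentialGeneratingFunctions

/-! ### The generating function of the local h-polynomials, its recurrence and its coefficients. -/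

section LocalH

/-- The sequence `q` with `q 0 = 1` and `q n = ∑_{k < n} (n choose k) q_k g_{n - k}`. -/
def compSeq {R : Type*} [CommRing R] (g : ℕ → R) : ℕ → R
  | 0 => 1
  | n + 1 => ∑ k : Fin (n + 1), ((n + 1).choose k : R) * compSeq g k * g (n + 1 - k)

theorem compSeq_eq {R : Type*} [CommRing R] (g : ℕ → R) {n : ℕ} (hn : n ≠ 0) :
    compSeq g n = ∑ k ∈ range n, (n.choose k : R) * compSeq g k * g (n - k) := by
  obtain ⟨n, rfl⟩ := Nat.exists_eq_succ_of_ne_zero hn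
  rw [compSeq, ← Fin.sum_univ_eq_sum_range
    (fun k => ((n + 1).choose k : R) * compSeq g k * g (n + 1 - k))]

theorem sum_ssubsets_apply_card {V R : Type*} [DecidableEq V] [CommRing R] (S : Finset V)
    (f : ℕ → R) : ∑ T ∈ S.ssubsets, f #T = ∑ k ∈ range #S, (#S).choose k * f k := by
  have h := sum_powerset_apply_card f (x := S)
  rw [← add_sum_erase _ _ (mem_powerset_self S), sum_range_succ, Nat.choose_self, add_comm] at h
  simp only [nsmul_eq_mul, Nat.cast_one, one_mul] at h
  exact add_right_cancel h

/-- The recursion sees `T` only through its cardinality, so by induction the values depend only on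
`#S`, and binomial coefficients count the subsets of each size. -/
theorem eq_compSeq {V R : Type*} [DecidableEq V] [CommRing R] (g : ℕ → R) (f : Finset V → R)
    (h0 : f ∅ = 1) (h : ∀ S, S.Nonempty → f S = ∑ T ∈ S.ssubsets, f T * g (#S - #T))
    (S : Finset V) : f S = compSeq g #S := by
  induction S using Finset.strongInduction with
  | H S ih =>
    rcases S.eq_empty_or_nonempty with rfl | hS
    · rw [h0, card_empty, compSeq]
    · rw [h S hS, compSeq_eq g hS.card_ne_zero,
        sum_congr rfl fun T hT => by rw [ih T (mem_ssubsets.1 hT)],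
        sum_ssubsets_apply_card S fun k => compSeq g k * g (#S - k)]
      exact sum_congr rfl fun k _ => by ring

theorem carrierPoly_eq_compSeq {V : Type*} [DecidableEq V] [Fintype V] (S : Finset V) :
    carrierPoly S = compSeq (fun m => 1 - (1 - X : ℤ[X]) ^ m) #S := by
  refine eq_compSeq (fun m => 1 - (1 - X : ℤ[X]) ^ m) carrierPoly carrierPoly_empty ?_ S
  intro S hS
  rw [carrierPoly_eq hS]

/-- The form is that of an iterated binomial convolution, so that the generating function becomes a
product of three factors. -/
theorem ellA_eq_sum (n : ℕ) :
    ellA n = ∑ m ∈ range (n + 1), (n.choose m : ℤ[X]) * (∑ k ∈ range (m + 1), (m.choose k : ℤ[X]) *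
      compSeq (fun m => 1 - (1 - X : ℤ[X]) ^ m) k * (1 - X) ^ (m - k)) * (-1) ^ (n - m) := by
  have h : ∀ F : Finset (Fin n), hPoly (restriction (antiprismTriangulation (simplex n))
      PointedFace.face F) = ∑ k ∈ range (#F + 1), ((#F).choose k : ℤ[X]) *
        compSeq (fun m => 1 - (1 - X : ℤ[X]) ^ m) k * (1 - X) ^ (#F - k) := by
    intro F
    rw [simplex, hPoly_restriction, sum_congr rfl fun S _ => by rw [carrierPoly_eq_compSeq S],
      sum_powerset_apply_card (fun k => (1 - X : ℤ[X]) ^ (#F - k) * compSeq _ k)]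
    exact sum_congr rfl fun k _ => by rw [nsmul_eq_mul]; ring
  rw [ellA, localHPoly, Fintype.card_fin, sum_congr rfl fun F _ => by rw [h F],
    ← powerset_univ, sum_powerset_apply_card (fun m => (-1 : ℤ[X]) ^ (n - m) *
      ∑ k ∈ range (m + 1), (m.choose k : ℤ[X]) *
        compSeq (fun m => 1 - (1 - X : ℤ[X]) ^ m) k * (1 - X) ^ (m - k)),
    card_univ, Fintype.card_fin]
  exact sum_congr rfl fun k _ => by rw [nsmul_eq_mul]; ring

/-- The local `h`-polynomial with rational coefficients. -/
def ellQ (n : ℕ) : ℚ[X] := (ellA n).map (Int.castRingHom ℚ)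

theorem egf_ellQ :
    egf ellQ * (1 - (expSeries (X : ℚ[X]) - 1) * (expSeries 1 - 1)) = 1 := by
  set q : ℕ → ℚ[X] := fun n =>
    (compSeq (fun m => 1 - (1 - X : ℤ[X]) ^ m) n).map (Int.castRingHom ℚ) with hq
  have hq0 : q 0 = 1 := by simp [hq, compSeq]
  have hqs : ∀ n, n ≠ 0 → q n = ∑ k ∈ range n, (n.choose k : ℚ[X]) * q k *
      (1 - (1 - X) ^ (n - k)) := by
    intro n hn
    simp only [hq]
    rw [compSeq_eq _ hn, Polynomial.map_sum]
    exact sum_congr rfl fun k _ => by simp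
  -- The recursion for `q` reads $q=1+q\,(e^z-e^{(1-x)z})$.
  have h1 : egf q * (1 - expSeries 1 + expSeries (1 - X)) = 1 := by
    rw [← egf_ite, expSeries, expSeries, ← egf_sub, ← egf_add, egf_mul]
    congr 1
    ext1 n
    rw [sum_range_succ, Nat.sub_self]
    simp only [if_true, pow_zero, Nat.choose_self, Nat.cast_one, one_mul, sub_self, zero_add,
      mul_one, one_pow]
    split_ifs with hn
    · simp [hn, hq0]
    · conv_lhs => rw [hqs n hn]
      rw [← sum_add_distrib]
      refine sum_eq_zero fun k hk => ?_
      rw [if_neg (by have := mem_range.1 hk; omega)]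
      ring
  have h2 : egf ellQ = egf q * expSeries (1 - X) * expSeries (-1) := by
    rw [expSeries, expSeries, egf_mul, egf_mul]
    congr 1
    ext1 n
    rw [ellQ, ellA_eq_sum, Polynomial.map_sum]
    refine sum_congr rfl fun m _ => ?_
    simp only [Polynomial.map_mul, Polynomial.map_sum, hq]
    simp
  have h3 : expSeries (1 - X : ℚ[X]) * expSeries (-1) = expSeries (-X) := by
    rw [expSeries_mul]; congr 1; ring
  have h4 : expSeries (-X : ℚ[X]) * expSeries X = 1 := by
    rw [expSeries_mul, neg_add_cancel, expSeries_zero]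
  have h5 : expSeries (-X : ℚ[X]) * expSeries 1 = expSeries (1 - X) := by
    rw [expSeries_mul]; congr 1; ring
  rw [h2, mul_assoc (egf q), h3]
  linear_combination h1 + (egf q) * (1 - expSeries 1) * h4 + (egf q) * h5

theorem ellQ_recurrence {n : ℕ} (hn : 1 ≤ n) :
    ellQ n = ∑ k ∈ range n, (n.choose k : ℚ[X]) * ellQ k * ((1 + X) ^ (n - k) - 1 - X ^ (n - k)) := by
  have h := egf_ellQ
  -- The denominator is $e^{xz}+e^z-e^{(1+x)z}$. Its constant term is 1, so the summand `k = n` of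
  -- the convolution is `ellQ n` itself.
  have h' : (1 - (expSeries (X : ℚ[X]) - 1) * (expSeries 1 - 1)) =
      egf fun m => X ^ m + 1 ^ m - (1 + X) ^ m := by
    rw [egf_sub, egf_add, ← expSeries, ← expSeries, ← expSeries, ← expSeries_mul]
    ring
  rw [h', egf_mul, ← egf_ite] at h
  have h := congrFun (egf_injective h) n
  simp only [sum_range_succ, Nat.sub_self, pow_zero, Nat.choose_self, if_neg (by omega : ¬ n = 0)]
    at h
  rw [← sub_eq_zero, ← h, sub_eq_iff_eq_add, add_right_comm, ← sum_add_distrib]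
  rw [sum_eq_zero fun k _ => by ring]
  simp

theorem ellA_recurrence {n : ℕ} (hn : 1 ≤ n) :
    ellA n = ∑ k ∈ range n, (n.choose k : ℤ[X]) * ellA k * ((1 + X) ^ (n - k) - 1 - X ^ (n - k)) := by
  apply Polynomial.map_injective (Int.castRingHom ℚ) (RingHom.injective_int _)
  have h := ellQ_recurrence hn
  simp only [ellQ] at h
  rw [h, Polynomial.map_sum]
  simp

/-- Expands $1/(1-u)$ with $u=(e^{xz}-1)(e^z-1)$. Since $z$ divides $u$, the powers beyond $u^n$ do
not affect the coefficient of $z^n$, so a finite geometric sum suffices. -/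
theorem ellQ_eq (n : ℕ) :
    ellQ n = ∑ k ∈ range (n + 1), (n.choose k : ℚ[X]) *
      (∑ j ∈ range (n + 1), (ordStirling j k : ℚ[X]) * (ordStirling j (n - k) : ℚ[X])) * X ^ k := by
  set u := (expSeries (X : ℚ[X]) - 1) * (expSeries 1 - 1) with hu
  have h1 : ∑ j ∈ range (n + 1), u ^ j = egf fun N => ∑ k ∈ range (N + 1), (N.choose k : ℚ[X]) *
      (∑ j ∈ range (n + 1), (ordStirling j k : ℚ[X]) * (ordStirling j (N - k) : ℚ[X])) * X ^ k := by
    have : ∀ j, u ^ j = egf (fun N => (X : ℚ[X]) ^ N * (ordStirling j N : ℚ[X])) *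
        egf (fun N => (ordStirling j N : ℚ[X])) := by
      intro j
      rw [← rescale_egf, egf_ordStirling, map_pow, map_sub, map_one, rescale_expSeries, mul_one,
        hu, mul_pow]
    rw [sum_congr rfl fun j _ => this j, sum_congr rfl fun j _ => egf_mul _ _, ← egf_sum]
    congr 1
    ext1 N
    rw [sum_comm]
    refine sum_congr rfl fun k _ => ?_
    rw [mul_sum, sum_mul]
    exact sum_congr rfl fun j _ => by ring
  have h2 : egf ellQ = ∑ j ∈ range (n + 1), u ^ j + egf ellQ * u ^ (n + 1) := by
    have h := geom_sum_mul u (n + 1)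
    have h' := egf_ellQ
    rw [← hu] at h'
    linear_combination egf ellQ * h + (∑ j ∈ range (n + 1), u ^ j) * h'
  have h3 : PowerSeries.coeff n (egf ellQ * u ^ (n + 1)) = 0 := by
    have : (PowerSeries.X : PowerSeries ℚ[X]) ∣ u := by
      rw [PowerSeries.X_dvd_iff, hu, map_mul, map_sub, map_one, constantCoeff_expSeries, sub_self,
        zero_mul]
    exact PowerSeries.X_pow_dvd_iff.1 ((pow_dvd_pow_of_dvd this (n + 1)).mul_left _) n
      (Nat.lt_succ_self n)
  rw [← factorial_mul_coeff_egf ellQ, h2, map_add, h3, add_zero, h1, factorial_mul_coeff_egf]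

theorem coeff_ellA (n k : ℕ) :
    (ellA n).coeff k = ((n.choose k * ∑ j ∈ range (n + 1),
      ordStirling j k * ordStirling j (n - k) : ℕ) : ℤ) := by
  have h : (ellQ n).coeff k = ((n.choose k * ∑ j ∈ range (n + 1),
      ordStirling j k * ordStirling j (n - k) : ℕ) : ℚ) := by
    have : ∀ k, (n.choose k : ℚ[X]) * (∑ j ∈ range (n + 1), (ordStirling j k : ℚ[X]) *
        (ordStirling j (n - k) : ℚ[X])) * X ^ k = C ((n.choose k * ∑ j ∈ range (n + 1),
      ordStirling j k * ordStirling j (n - k) : ℕ) : ℚ) * X ^ k := by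
      intro k
      simp
    rw [ellQ_eq, sum_congr rfl fun k _ => this k, finsetSum_coeff]
    simp only [coeff_C_mul_X_pow]
    rw [sum_ite_eq]
    split_ifs with hk
    · rfl
    · rw [Nat.choose_eq_zero_of_lt (by simpa using hk)]
      simp
  rw [ellQ, coeff_map, eq_intCast] at h
  exact_mod_cast h

end LocalH

/-! ### Counting ordered partitions and complementary pairs of them. -/

section OrderedPartitions

variable {α : Type*} [DecidableEq α]

@[simp]
theorem blockUnion_nil : blockUnion ([] : List (Finset α)) = ∅ := rfl

@[simp]
theorem blockUnion_cons (B : Finset α) (π : List (Finset α)) :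
    blockUnion (B :: π) = B ∪ blockUnion π := rfl

theorem mem_blockUnion {π : List (Finset α)} {x : α} : x ∈ blockUnion π ↔ ∃ B ∈ π, x ∈ B := by
  induction π with
  | nil => simp
  | cons B π ih => simp [ih]

theorem blockUnion_append (π τ : List (Finset α)) :
    blockUnion (π ++ τ) = blockUnion π ∪ blockUnion τ := by
  ext x
  simp only [mem_blockUnion, mem_union, List.mem_append, or_and_right, exists_or]

theorem subset_blockUnion {π : List (Finset α)} {B : Finset α} (h : B ∈ π) : B ⊆ blockUnion π :=
  fun _ hx => mem_blockUnion.2 ⟨B, h, hx⟩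

theorem isOrderedPartition_nil {S : Finset α} : IsOrderedPartition S [] ↔ S = ∅ := by
  simp [IsOrderedPartition, eq_comm]

theorem isOrderedPartition_append {S : Finset α} {π τ : List (Finset α)} :
    IsOrderedPartition S (π ++ τ) ↔ blockUnion π ⊆ S ∧ IsOrderedPartition (blockUnion π) π ∧
      IsOrderedPartition (S \ blockUnion π) τ := by
  simp only [IsOrderedPartition, List.pairwise_append, blockUnion_append, List.mem_append]
  constructor
  · rintro ⟨h1, ⟨h2, h3, h4⟩, rfl⟩
    refine ⟨subset_union_left, ⟨fun B hB => h1 B (Or.inl hB), h2, trivial⟩,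
      fun B hB => h1 B (Or.inr hB), h3, ?_⟩
    rw [union_sdiff_left, sdiff_eq_self_of_disjoint]
    rw [disjoint_left]
    intro x hx hx'
    obtain ⟨B, hB, hxB⟩ := mem_blockUnion.1 hx
    obtain ⟨C, hC, hxC⟩ := mem_blockUnion.1 hx'
    exact disjoint_left.1 (h4 C hC B hB) hxC hxB
  · rintro ⟨h1, ⟨h2, h3, -⟩, h4, h5, h6⟩
    refine ⟨?_, ⟨h3, h5, ?_⟩, by rw [h6, union_sdiff_of_subset h1]⟩
    · rintro B (hB | hB)
      exacts [h2 B hB, h4 B hB]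
    · intro B hB C hC
      exact disjoint_of_subset_left (subset_blockUnion hB)
        (disjoint_of_subset_right (h6 ▸ subset_blockUnion hC) disjoint_sdiff)

theorem isOrderedPartition_cons {S B : Finset α} {π : List (Finset α)} :
    IsOrderedPartition S (B :: π) ↔ B ⊆ S ∧ B.Nonempty ∧ IsOrderedPartition (S \ B) π := by
  rw [← List.singleton_append, isOrderedPartition_append]
  simp [IsOrderedPartition]

theorem IsOrderedPartition.map_filter {S : Finset α} {π : List (Finset α)}
    (h : IsOrderedPartition S π) (p : α → Prop) [DecidablePred p]
    (hp : ∀ B ∈ π, (B.filter p).Nonempty) :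
    IsOrderedPartition (S.filter p) (π.map fun B => B.filter p) := by
  refine ⟨?_, ?_, ?_⟩
  · simpa using hp
  · rw [List.pairwise_map]
    exact h.2.1.imp fun h => disjoint_of_subset_left (filter_subset _ _)
      (disjoint_of_subset_right (filter_subset _ _) h)
  · rw [← h.2.2]
    ext x
    simp only [mem_blockUnion, mem_filter, List.mem_map]
    aesop

/-- The ordered partitions of `S` with `j` blocks. -/
def orderedPartitions : ℕ → Finset α → Finset (List (Finset α))
  | 0, S => if S = ∅ then {[]} else ∅
  | j + 1, S => (S.powerset.erase ∅).biUnion fun B =>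
      (orderedPartitions j (S \ B)).map ⟨List.cons B, List.cons_injective⟩

theorem mem_orderedPartitions {j : ℕ} {S : Finset α} {π : List (Finset α)} :
    π ∈ orderedPartitions j S ↔ IsOrderedPartition S π ∧ π.length = j := by
  induction j generalizing S π with
  | zero =>
    rw [orderedPartitions, List.length_eq_zero_iff]
    constructor
    · intro h
      split_ifs at h with hS
      · rw [mem_singleton.1 h]
        exact ⟨isOrderedPartition_nil.2 hS, rfl⟩
      · simp at h
    · rintro ⟨h, rfl⟩
      simp [isOrderedPartition_nil.1 h]
  | succ j ih =>
    simp only [orderedPartitions, mem_biUnion, mem_erase, mem_powerset, mem_map,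
      Function.Embedding.coeFn_mk, ih]
    constructor
    · rintro ⟨B, ⟨hB, hBS⟩, τ, ⟨hτ, rfl⟩, rfl⟩
      exact ⟨isOrderedPartition_cons.2 ⟨hBS, nonempty_iff_ne_empty.2 hB, hτ⟩, rfl⟩
    · rintro ⟨h, hl⟩
      cases π with
      | nil => simp at hl
      | cons B τ =>
        obtain ⟨h1, h2, h3⟩ := isOrderedPartition_cons.1 h
        exact ⟨B, ⟨h2.ne_empty, h1⟩, τ, ⟨h3, by simpa using hl⟩, rfl⟩

theorem sum_powerset_erase_empty_sdiff (S : Finset α) (f : ℕ → ℕ) :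
    ∑ B ∈ S.powerset.erase ∅, f #(S \ B) = ∑ m ∈ range #S, (#S).choose m * f m := by
  have h : ∑ B ∈ S.powerset.erase ∅, f #(S \ B) = ∑ T ∈ S.ssubsets, f #T := by
    refine sum_nbij' (fun B => S \ B) (fun B => S \ B) ?_ ?_ ?_ ?_ fun _ _ => rfl
    · intro B hB
      simp only [mem_erase, mem_powerset] at hB
      exact mem_ssubsets.2 (sdiff_ssubset hB.2 (nonempty_iff_ne_empty.2 hB.1))
    · intro B hB
      have hB := mem_ssubsets.1 hB
      simp only [mem_erase, mem_powerset]
      exact ⟨(sdiff_nonempty.2 hB.not_subset).ne_empty, sdiff_subset⟩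
    · intro B hB
      simp only [mem_erase, mem_powerset] at hB
      exact Finset.sdiff_sdiff_eq_self hB.2
    · intro B hB
      exact Finset.sdiff_sdiff_eq_self (mem_ssubsets.1 hB).subset
  rw [h, ← Nat.cast_inj (R := ℤ)]
  push_cast
  exact sum_ssubsets_apply_card S fun k => (f k : ℤ)

theorem card_orderedPartitions (j : ℕ) (S : Finset α) :
    #(orderedPartitions j S) = ordStirling j #S := by
  induction j generalizing S with
  | zero =>
    rw [orderedPartitions, ordStirling]
    split_ifs with h
    · simp [h]
    · obtain ⟨n, hn⟩ := Nat.exists_eq_succ_of_ne_zero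
        (nonempty_iff_ne_empty.2 h).card_ne_zero
      rw [hn, Nat.succ_eq_add_one, Nat.stirlingSecond_succ_zero]
      simp
  | succ j ih =>
    rw [orderedPartitions, card_biUnion]
    · simp only [card_map, ih]
      rw [sum_powerset_erase_empty_sdiff S (ordStirling j), ordStirling_succ]
    · intro B _ C _ hBC
      rw [Function.onFun, disjoint_left]
      simp only [mem_map, Function.Embedding.coeFn_mk]
      rintro _ ⟨τ, _, rfl⟩ ⟨τ', _, h⟩
      exact hBC (List.cons.inj h).1.symm

theorem IsOrderedPartition.length_le {S : Finset α} {π : List (Finset α)}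
    (h : IsOrderedPartition S π) : π.length ≤ #S := by
  induction π generalizing S with
  | nil => simp
  | cons B π ih =>
    obtain ⟨h1, h2, h3⟩ := isOrderedPartition_cons.1 h
    have h4 := ih h3
    rw [card_sdiff_of_subset h1] at h4
    have h5 := h2.card_pos
    have h6 := card_le_card h1
    rw [List.length_cons]
    omega

variable [Fintype α]

/-- Pairs of ordered partitions with the same number of blocks of complementary sets, the first of
which has `k` elements. -/
def partitionPairs (α : Type*) [DecidableEq α] [Fintype α] (k : ℕ) :
    Set (List (Finset α) × List (Finset α)) :=
  {p | ∃ S : Finset α, #S = k ∧ IsOrderedPartition S p.1 ∧ IsOrderedPartition Sᶜ p.2 ∧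
    p.1.length = p.2.length}

/-- The set `S` and the common length `j` are recovered from the pair, so the unions are disjoint.
Blocks are nonempty, which bounds `j`. -/
theorem ncard_partitionPairs (k : ℕ) :
    (partitionPairs α k).ncard = (Fintype.card α).choose k *
      ∑ j ∈ range (Fintype.card α + 1), ordStirling j k * ordStirling j (Fintype.card α - k) := by
  have h : partitionPairs α k = ((powersetCard k (univ : Finset α)).biUnion fun S =>
      (range (Fintype.card α + 1)).biUnion fun j =>
        orderedPartitions j S ×ˢ orderedPartitions j Sᶜ : Finset _) := by
    ext ⟨π, τ⟩
    simp only [partitionPairs, Set.mem_ofPred_eq, coe_biUnion, Set.mem_iUnion, mem_coe,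
      mem_powersetCard, subset_univ, true_and, mem_product, mem_orderedPartitions, mem_range,
      exists_prop]
    constructor
    · rintro ⟨S, hS, h1, h2, h3⟩
      exact ⟨S, hS, π.length, Nat.lt_succ_of_le (h1.length_le.trans (card_le_univ S)),
        ⟨h1, rfl⟩, h2, h3.symm⟩
    · rintro ⟨S, hS, j, _, ⟨h1, rfl⟩, h2, h3⟩
      exact ⟨S, hS, h1, h2, h3.symm⟩
  rw [h, Set.ncard_coe_finset, card_biUnion, sum_const_nat (m := ∑ j ∈ range (Fintype.card α + 1),
      ordStirling j k * ordStirling j (Fintype.card α - k)), card_powersetCard, card_univ]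
  · intro S hS
    have hS := (mem_powersetCard.1 hS).2
    rw [card_biUnion]
    · refine sum_congr rfl fun j _ => ?_
      rw [card_product, card_orderedPartitions, card_orderedPartitions, card_compl, hS]
    · intro i _ j _ hij
      rw [Function.onFun, disjoint_left]
      rintro ⟨π, τ⟩ h1 h2
      simp only [mem_product, mem_orderedPartitions] at h1 h2
      exact hij (h1.1.2.symm.trans h2.1.2)
  · intro S _ T _ hST
    rw [Function.onFun, disjoint_left]
    rintro ⟨π, τ⟩ h1 h2
    simp only [mem_biUnion, mem_product, mem_orderedPartitions] at h1 h2
    obtain ⟨i, _, h1, _⟩ := h1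
    obtain ⟨j, _, h2, _⟩ := h2
    exact hST (h1.1.2.2.symm.trans h2.1.2.2)

end OrderedPartitions

/-! ### Bijections between the families of ordered partitions. -/

section Bijections

/-- Concatenation, with inverse cutting in the middle. -/
theorem ncard_evenPartitions (n k : ℕ) :
    (evenPartitions n k).ncard = (partitionPairs (Fin n) k).ncard := by
  symm
  refine Set.ncard_congr (fun p _ => p.1 ++ p.2) ?_ ?_ ?_
  · rintro ⟨π, τ⟩ ⟨S, hS, h1, h2, h3⟩
    dsimp only at *
    have h4 : blockUnion π = S := h1.2.2
    have h5 : (π ++ τ).length / 2 = π.length := by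
      rw [List.length_append, ← h3]; omega
    refine ⟨isOrderedPartition_append.2 ⟨subset_univ _, by rwa [h4], ?_⟩, ?_, ?_⟩
    · rwa [h4, ← compl_eq_univ_sdiff]
    · rw [List.length_append, ← h3]
      exact ⟨_, rfl⟩
    · rw [h5, List.take_left, h4, hS]
  · rintro ⟨π, τ⟩ ⟨π', τ'⟩ ⟨S, hS, h1, h2, h3⟩ ⟨S', hS', h1', h2', h3'⟩ h
    dsimp only at *
    have h6 := congrArg List.length h
    simp only [List.length_append] at h6
    obtain ⟨h7, h8⟩ := List.append_inj h (by omega)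
    rw [h7, h8]
  · rintro π ⟨h1, h2, h3⟩
    refine ⟨(π.take (π.length / 2), π.drop (π.length / 2)),
      ⟨blockUnion (π.take (π.length / 2)), h3, ?_⟩, List.take_append_drop _ _⟩
    rw [← List.take_append_drop (π.length / 2) π] at h1
    obtain ⟨_, h4, h5⟩ := isOrderedPartition_append.1 h1
    refine ⟨h4, by rwa [compl_eq_univ_sdiff], ?_⟩
    obtain ⟨r, hr⟩ := h2
    simp only [List.length_take, List.length_drop]
    omega

variable {α : Type*}

theorem not_isMonochromatic_iff {c : α → Bool} {B : Finset α} :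
    ¬ IsMonochromatic c B ↔ (B.filter fun x => c x = true).Nonempty ∧
      (B.filter fun x => ¬ c x = true).Nonempty := by
  simp only [IsMonochromatic, Bool.exists_bool, not_or, not_forall, Finset.Nonempty, mem_filter,
    exists_prop, Bool.not_eq_true, Bool.not_eq_false]

theorem coloring_eq_of_filter_eq [Fintype α] {c d : α → Bool}
    (h : (univ.filter fun x => c x = true) = univ.filter fun x => d x = true) : c = d := by
  ext x
  have := Finset.ext_iff.1 h x
  simp only [mem_filter, mem_univ, true_and] at this
  exact Bool.eq_iff_iff.2 this

variable [DecidableEq α]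

/-- The ordered partition with blocks `B_i ∪ C_i`, for complementary `B_i` and `C_i`. -/
theorem exists_merge {c : α → Bool} {U : Finset α} {π τ : List (Finset α)}
    (hπ : IsOrderedPartition (U.filter fun x => c x = true) π)
    (hτ : IsOrderedPartition (U.filter fun x => ¬ c x = true) τ) (hl : π.length = τ.length) :
    ∃ ρ, IsOrderedPartition U ρ ∧ (ρ.map fun B => B.filter fun x => c x = true) = π ∧
      (ρ.map fun B => B.filter fun x => ¬ c x = true) = τ := by
  induction π generalizing U τ with
  | nil =>
    obtain rfl : τ = [] := by simpa [eq_comm] using hl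
    rw [isOrderedPartition_nil] at hπ hτ
    refine ⟨[], isOrderedPartition_nil.2 ?_, rfl, rfl⟩
    rw [← filter_union_filter_not_eq (fun x => c x = true) U, hπ, hτ, empty_union]
  | cons B π ih =>
    cases τ with
    | nil => simp at hl
    | cons C τ =>
      obtain ⟨h1, h2, h3⟩ := isOrderedPartition_cons.1 hπ
      obtain ⟨h4, h5, h6⟩ := isOrderedPartition_cons.1 hτ
      have hB : ∀ x ∈ B, c x = true := fun x hx => (mem_filter.1 (h1 hx)).2
      have hC : ∀ x ∈ C, ¬ c x = true := fun x hx => (mem_filter.1 (h4 hx)).2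
      have h7 : ((U \ (B ∪ C)).filter fun x => c x = true) =
          (U.filter fun x => c x = true) \ B := by
        ext x
        simp only [mem_filter, mem_sdiff, mem_union]
        have := hC x
        tauto
      have h8 : ((U \ (B ∪ C)).filter fun x => ¬ c x = true) =
          (U.filter fun x => ¬ c x = true) \ C := by
        ext x
        simp only [mem_filter, mem_sdiff, mem_union]
        have := hB x
        tauto
      obtain ⟨ρ, hρ, hρ1, hρ2⟩ := ih (U := U \ (B ∪ C)) (by rwa [h7]) (by rwa [h8])
        (by simpa using hl)
      refine ⟨(B ∪ C) :: ρ, isOrderedPartition_cons.2 ⟨?_, h2.mono subset_union_left, hρ⟩, ?_, ?_⟩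
      · exact union_subset (h1.trans (filter_subset _ _)) (h4.trans (filter_subset _ _))
      · rw [List.map_cons, hρ1, filter_union, filter_true_of_mem hB, filter_false_of_mem hC,
          union_empty]
      · rw [List.map_cons, hρ2, filter_union, filter_false_of_mem (fun x hx => not_not.2 (hB x hx)),
          filter_true_of_mem hC, empty_union]

theorem eq_of_map_filter_eq {c : α → Bool} {π τ : List (Finset α)}
    (h1 : (π.map fun B => B.filter fun x => c x = true) =
      τ.map fun B => B.filter fun x => c x = true)
    (h2 : (π.map fun B => B.filter fun x => ¬ c x = true) =
      τ.map fun B => B.filter fun x => ¬ c x = true) : π = τ := by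
  have hinj : Function.Injective fun B : Finset α =>
      (B.filter fun x => c x = true, B.filter fun x => ¬ c x = true) := by
    intro B C h
    obtain ⟨h1, h2⟩ := Prod.mk.inj h
    rw [← filter_union_filter_not_eq (fun x => c x = true) B, h1, h2, filter_union_filter_not_eq]
  refine List.map_injective_iff.2 hinj ?_
  induction π generalizing τ with
  | nil =>
    cases τ with
    | nil => rfl
    | cons => simp at h1
  | cons B π ih =>
    cases τ with
    | nil => simp at h1
    | cons C τ =>
      simp only [List.map_cons, List.cons.injEq] at h1 h2 ⊢
      exact ⟨by rw [h1.1, h2.1], ih h1.2 h2.2⟩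

/-- Each block splits into its black and white parts, both nonempty exactly when it is not
monochromatic. The union of the black parts recovers the coloring. -/
theorem ncard_coloredPartitions (n k : ℕ) :
    (coloredPartitions n k).ncard = (partitionPairs (Fin n) k).ncard := by
  have hc : ∀ c : Fin n → Bool, (univ.filter fun x => c x = true)ᶜ =
      univ.filter fun x => ¬ c x = true := fun c => by ext x; simp
  have key : ∀ φ ∈ coloredPartitions n k,
      IsOrderedPartition (univ.filter fun x => φ.2 x = true)
        (φ.1.map fun B => B.filter fun x => φ.2 x = true) ∧
      IsOrderedPartition (univ.filter fun x => ¬ φ.2 x = true)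
        (φ.1.map fun B => B.filter fun x => ¬ φ.2 x = true) := by
    rintro ⟨π, c⟩ ⟨h1, _, h3⟩
    exact ⟨h1.map_filter _ fun B hB => (not_isMonochromatic_iff.1 (h3 B hB)).1,
      h1.map_filter _ fun B hB => (not_isMonochromatic_iff.1 (h3 B hB)).2⟩
  refine Set.ncard_congr (fun φ _ => (φ.1.map fun B => B.filter fun x => φ.2 x = true,
    φ.1.map fun B => B.filter fun x => ¬ φ.2 x = true)) ?_ ?_ ?_
  · intro φ h
    refine ⟨_, h.2.1, (key φ h).1, ?_, ?_⟩
    · rw [hc]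
      exact (key φ h).2
    · simp
  · rintro ⟨π, c⟩ ⟨τ, d⟩ h h' heq
    obtain ⟨h1, h2⟩ := Prod.mk.inj heq
    have h3 : c = d := by
      apply coloring_eq_of_filter_eq
      rw [← (key _ h).1.2.2, ← (key _ h').1.2.2, h1]
    subst h3
    exact Prod.ext (eq_of_map_filter_eq h1 h2) rfl
  · rintro ⟨π, τ⟩ ⟨S, hS, h1, h2, h3⟩
    have hS' : (univ.filter fun x => decide (x ∈ S) = true) = S := by ext x; simp
    have hS'' : (univ.filter fun x => ¬ decide (x ∈ S) = true) = Sᶜ := by ext x; simp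
    obtain ⟨ρ, hρ, hρ1, hρ2⟩ := exists_merge (c := fun x => decide (x ∈ S)) (U := univ)
      (by rwa [hS']) (by rwa [hS'']) h3
    refine ⟨(ρ, fun x => decide (x ∈ S)), ⟨hρ, by simp only [hS', hS], ?_⟩, Prod.ext hρ1 hρ2⟩
    intro B hB
    refine not_isMonochromatic_iff.2 ⟨h1.1 _ ?_, h2.1 _ ?_⟩
    · rw [← hρ1]
      exact List.mem_map_of_mem hB
    · rw [← hρ2]
      exact List.mem_map_of_mem hB

theorem weight_eq_card {S : Finset α} {τ : List (Finset α)} (h : IsOrderedPartition S τ) :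
    weight τ = #S := by
  induction τ generalizing S with
  | nil => simp [weight, isOrderedPartition_nil.1 h]
  | cons B τ ih =>
    obtain ⟨h1, _, h3⟩ := isOrderedPartition_cons.1 h
    have := ih h3
    rw [card_sdiff_of_subset h1] at this
    have := card_le_card h1
    simp only [weight, List.map_cons, List.sum_cons] at *
    omega

/-- The blocks of `τ` are the intersections of those of `π` with the union of `τ`. -/
theorem map_filter_blockUnion {S : Finset α} {π τ : List (Finset α)}
    (hπ : IsOrderedPartition S π) (h : List.Forall₂ (fun B C => C ⊆ B) π τ) :
    (π.map fun B => B.filter fun x => x ∈ blockUnion τ) = τ := by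
  have hsub : ∀ {π τ : List (Finset α)}, List.Forall₂ (fun B C => C ⊆ B) π τ →
      blockUnion τ ⊆ blockUnion π := by
    intro π τ h
    induction h with
    | nil => simp
    | cons h1 _ ih => exact union_subset_union h1 ih
  induction h generalizing S with
  | nil => rfl
  | @cons B C π τ hCB hr ih =>
    obtain ⟨h1, h2, h3⟩ := isOrderedPartition_cons.1 hπ
    have h4 : Disjoint B (blockUnion π) := by
      rw [h3.2.2]
      exact disjoint_sdiff
    rw [List.map_cons]
    congr 1
    · ext x
      simp only [mem_filter, blockUnion_cons, mem_union]
      constructor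
      · rintro ⟨hx, hx' | hx'⟩
        · exact hx'
        · exact absurd (hsub hr hx') (disjoint_left.1 h4 hx)
      · exact fun hx => ⟨hCB hx, Or.inl hx⟩
    · conv_rhs => rw [← ih h3]
      refine List.map_congr_left fun D hD => filter_congr fun x hx => ?_
      have : x ∉ C := fun hxC =>
        disjoint_left.1 h4 (hCB hxC) (subset_blockUnion hD hx)
      simp [this]

/-- The chosen subset of a block is its black part. Being nonempty and proper means that both colors
occur. -/
theorem ncard_properMultiPointed (n k : ℕ) :
    (properMultiPointed n k).ncard = (coloredPartitions n k).ncard := by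
  symm
  have key : ∀ φ ∈ coloredPartitions n k, IsOrderedPartition (univ.filter fun x => φ.2 x = true)
        (φ.1.map fun B => B.filter fun x => φ.2 x = true) := by
    rintro ⟨π, c⟩ ⟨h1, _, h3⟩
    exact h1.map_filter _ fun B hB => (not_isMonochromatic_iff.1 (h3 B hB)).1
  refine Set.ncard_congr (fun φ _ => (φ.1, φ.1.map fun B => B.filter fun x => φ.2 x = true))
    ?_ ?_ ?_
  · intro φ h
    refine ⟨⟨h.1, ⟨_, subset_univ _, key φ h⟩, ?_⟩, ?_, ?_⟩
    · rw [List.forall₂_map_right_iff, List.forall₂_same]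
      exact fun B _ => filter_subset _ _
    · rw [IsProper, List.forall₂_map_right_iff, List.forall₂_same]
      intro B hB heq
      obtain ⟨x, hx⟩ := (not_isMonochromatic_iff.1 (h.2.2 B hB)).2
      obtain ⟨hx, hx'⟩ := mem_filter.1 hx
      rw [← heq] at hx
      exact hx' (mem_filter.1 hx).2
    · rw [weight_eq_card (key φ h), h.2.1]
  · rintro ⟨π, c⟩ ⟨τ, d⟩ h h' heq
    obtain ⟨rfl, h2⟩ := Prod.mk.inj heq
    have h3 : c = d := by
      apply coloring_eq_of_filter_eq
      rw [← (key _ h).2.2, ← (key _ h').2.2, h2]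
    rw [h3]
  · rintro ⟨π, τ⟩ ⟨⟨h1, ⟨T, _, h2⟩, h3⟩, h4, h5⟩
    dsimp only at *
    have h6 := map_filter_blockUnion h1 h3
    have hT : blockUnion τ = T := h2.2.2
    refine ⟨(π, fun x => decide (x ∈ blockUnion τ)), ⟨h1, ?_, ?_⟩, ?_⟩
    · rw [weight_eq_card h2] at h5
      simp [hT, h5]
    · intro B hB
      rw [not_isMonochromatic_iff]
      simp only [decide_eq_true_eq]
      have hB' : (B.filter fun x => x ∈ blockUnion τ) ∈ τ := by
        have := List.mem_map_of_mem (f := fun B => B.filter fun x => x ∈ blockUnion τ) hB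
        rwa [h6] at this
      refine ⟨h2.1 _ hB', ?_⟩
      have h7 : List.Forall₂ (fun B C => C ≠ B) π
          (π.map fun B => B.filter fun x => x ∈ blockUnion τ) := by rw [h6]; exact h4
      rw [List.forall₂_map_right_iff, List.forall₂_same] at h7
      rw [nonempty_iff_ne_empty]
      intro h8
      apply h7 B hB
      rw [← filter_union_filter_not_eq (fun x => x ∈ blockUnion τ) B, h8]
      simp
    · simpa using h6

end Bijections

/-! ### Permutations of a disjoint union with prescribed parts inside the summands. -/

section Gluing

variable {α β : Type*}

/-- The indices at which a partial function is undefined. -/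
abbrev Undef (f : α → Option α) := {i : α // f i = none}

/-- The values not attained by a partial function. -/
abbrev Unattained (f : α → Option α) := {y : α // ∀ i, f i ≠ some y}

/-- A partial function is injective where it is defined. -/
def IsPartialInjection (f : α → Option α) : Prop :=
  ∀ i i' y, f i = some y → f i' = some y → i = i'

/-- The part of `w` that stays inside the left summand. -/
def leftPart (w : Equiv.Perm (α ⊕ β)) (i : α) : Option α := (w (Sum.inl i)).getLeft?

/-- The part of `w` that stays inside the right summand. -/
def rightPart (w : Equiv.Perm (α ⊕ β)) (i : β) : Option β := (w (Sum.inr i)).getRight?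

theorem leftPart_eq_some {w : Equiv.Perm (α ⊕ β)} {i y : α} :
    leftPart w i = some y ↔ w (Sum.inl i) = Sum.inl y := Sum.getLeft?_eq_some_iff

theorem rightPart_eq_some {w : Equiv.Perm (α ⊕ β)} {i y : β} :
    rightPart w i = some y ↔ w (Sum.inr i) = Sum.inr y := Sum.getRight?_eq_some_iff

theorem isPartialInjection_leftPart (w : Equiv.Perm (α ⊕ β)) :
    IsPartialInjection (leftPart w) := fun _ _ _ h h' =>
  Sum.inl_injective (w.injective
    ((leftPart_eq_some.1 h).trans (leftPart_eq_some.1 h').symm))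

theorem isPartialInjection_rightPart (w : Equiv.Perm (α ⊕ β)) :
    IsPartialInjection (rightPart w) := fun _ _ _ h h' =>
  Sum.inr_injective (w.injective
    ((rightPart_eq_some.1 h).trans (rightPart_eq_some.1 h').symm))

/-- The indices leaving `α` are those where `f` is undefined, and they fill exactly the places of
`β` that `g` misses. Describing `f` and `g` by their values lets the mirror statement follow by
swapping the summands. -/
theorem exists_crossing_equiv (w : Equiv.Perm (α ⊕ β)) {f : α → Option α} {g : β → Option β}
    (hf : ∀ i y, f i = some y ↔ w (Sum.inl i) = Sum.inl y)
    (hg : ∀ i y, g i = some y ↔ w (Sum.inr i) = Sum.inr y) :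
    ∃ e : Undef f ≃ Unattained g, ∀ i, w (Sum.inl i.1) = Sum.inr (e i).1 := by
  have hf' : ∀ i y, w (Sum.inl i) = Sum.inr y → f i = none := by
    intro i y h
    rw [Option.eq_none_iff_forall_ne_some]
    intro z hz
    rw [hf, h] at hz
    simp at hz
  have h : ∀ i : Undef f, ∃ y : Unattained g, w (Sum.inl i.1) = Sum.inr y.1 := by
    intro i
    rcases hy : w (Sum.inl i.1) with y | y
    · have := (hf _ _).2 hy
      rw [i.2] at this
      simp at this
    · refine ⟨⟨y, fun j hj => ?_⟩, rfl⟩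
      have := w.injective (hy.trans ((hg _ _).1 hj).symm)
      simp at this
  choose e he using h
  refine ⟨Equiv.ofBijective e ⟨fun i j hij => ?_, fun y => ?_⟩, he⟩
  · have := (he i).trans ((congrArg (fun y => Sum.inr y.1) hij).trans (he j).symm)
    exact Subtype.ext (Sum.inl_injective (w.injective this))
  · rcases hx : w.symm (Sum.inr y.1) with i | j
    · have hi : w (Sum.inl i) = Sum.inr y.1 := by rw [← hx, Equiv.apply_symm_apply]
      refine ⟨⟨i, hf' _ _ hi⟩, Subtype.ext (Sum.inr_injective (β := β) (α := α) ?_)⟩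
      rw [← he, ← hi]
    · exact absurd ((hg _ _).2 (by rw [← hx, Equiv.apply_symm_apply])) (y.2 j)

theorem exists_crossing_equiv' (w : Equiv.Perm (α ⊕ β)) {f : α → Option α} {g : β → Option β}
    (hf : ∀ i y, f i = some y ↔ w (Sum.inl i) = Sum.inl y)
    (hg : ∀ i y, g i = some y ↔ w (Sum.inr i) = Sum.inr y) :
    ∃ e : Undef g ≃ Unattained f, ∀ i, w (Sum.inr i.1) = Sum.inl (e i).1 := by
  obtain ⟨e, he⟩ := exists_crossing_equiv ((Equiv.sumComm α β).permCongr w) (f := g) (g := f)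
    (fun i y => by
      rw [hg, Equiv.permCongr_apply, ← Equiv.eq_symm_apply (Equiv.sumComm α β)]; simp)
    (fun i y => by
      rw [hf, Equiv.permCongr_apply, ← Equiv.eq_symm_apply (Equiv.sumComm α β)]; simp)
  refine ⟨e, fun i => ?_⟩
  have := he i
  rw [Equiv.permCongr_apply, ← Equiv.eq_symm_apply (Equiv.sumComm α β)] at this
  simpa using this

/-- The map that agrees with `f` and `g` where they are defined and with `a` and `b` elsewhere. -/
def glue (f : α → Option α) (g : β → Option β) (a : Undef f → β) (b : Undef g → α) :
    α ⊕ β → α ⊕ β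
  | Sum.inl i => if h : f i = none then Sum.inr (a ⟨i, h⟩) else
      Sum.inl ((f i).get (Option.isSome_iff_ne_none.2 h))
  | Sum.inr i => if h : g i = none then Sum.inl (b ⟨i, h⟩) else
      Sum.inr ((g i).get (Option.isSome_iff_ne_none.2 h))

variable {f : α → Option α} {g : β → Option β}

section

variable (a : Undef f → β) (b : Undef g → α)

theorem glue_inl_none (i : Undef f) : glue f g a b (Sum.inl i.1) = Sum.inr (a i) := by
  simp [glue, i.2]

theorem glue_inr_none (i : Undef g) : glue f g a b (Sum.inr i.1) = Sum.inl (b i) := by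
  simp [glue, i.2]

theorem glue_inl_some {i y : α} (h : f i = some y) :
    glue f g a b (Sum.inl i) = Sum.inl y := by
  simp [glue, h]

theorem glue_inr_some {i y : β} (h : g i = some y) :
    glue f g a b (Sum.inr i) = Sum.inr y := by
  simp [glue, h]

end

/-- Within each summand, crossing values are unattained by the partial injection there, so they
never meet its values. Each of the two kinds of values is injective by itself. -/
theorem glue_injective (hf : IsPartialInjection f) (hg : IsPartialInjection g)
    (a : Undef f ≃ Unattained g) (b : Undef g ≃ Unattained f) :
    Function.Injective (glue f g (fun i => (a i).1) fun i => (b i).1) := by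
  set a' : Undef f → β := fun i => (a i).1 with ha
  set b' : Undef g → α := fun i => (b i).1 with hb
  have key : ∀ x : α ⊕ β, (∃ i : Undef f, x = Sum.inl i.1 ∧ glue f g a' b' x = Sum.inr (a i).1) ∨
      (∃ i y, f i = some y ∧ x = Sum.inl i ∧ glue f g a' b' x = Sum.inl y) ∨
      (∃ i : Undef g, x = Sum.inr i.1 ∧ glue f g a' b' x = Sum.inl (b i).1) ∨
      (∃ i y, g i = some y ∧ x = Sum.inr i ∧ glue f g a' b' x = Sum.inr y) := by
    rintro (i | i)
    · rcases h : f i with _ | y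
      · exact Or.inl ⟨⟨i, h⟩, rfl, glue_inl_none a' b' ⟨i, h⟩⟩
      · exact Or.inr (Or.inl ⟨i, y, h, rfl, glue_inl_some a' b' h⟩)
    · rcases h : g i with _ | y
      · exact Or.inr (Or.inr (Or.inl ⟨⟨i, h⟩, rfl, glue_inr_none a' b' ⟨i, h⟩⟩))
      · exact Or.inr (Or.inr (Or.inr ⟨i, y, h, rfl, glue_inr_some a' b' h⟩))
  intro x x' hx
  rcases key x with ⟨i, rfl, h⟩ | ⟨i, y, hi, rfl, h⟩ | ⟨i, rfl, h⟩ | ⟨i, y, hi, rfl, h⟩ <;>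
  rcases key x' with ⟨i', rfl, h'⟩ | ⟨i', y', hi', rfl, h'⟩ | ⟨i', rfl, h'⟩ | ⟨i', y', hi', rfl, h'⟩ <;>
  rw [h, h'] at hx <;> simp only [Sum.inl.injEq, Sum.inr.injEq, reduceCtorEq] at hx
  · rw [a.injective (Subtype.ext hx)]
  · exact absurd (hx ▸ hi') ((a i).2 i')
  · subst hx; rw [hf _ _ _ hi hi']
  · exact absurd (hx ▸ hi) ((b i').2 i)
  · exact absurd (hx ▸ hi') ((b i).2 i')
  · rw [b.injective (Subtype.ext hx)]
  · exact absurd (hx ▸ hi) ((a i').2 i)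
  · subst hx; rw [hg _ _ _ hi hi']

variable [Fintype α] [Fintype β]

/-- A partial injection matches the indices where it is defined with the values it attains; pass to
complements. -/
theorem card_unattained (hf : IsPartialInjection f) :
    Nat.card (Unattained f) = Nat.card (Undef f) := by
  classical
  have h : Nat.card {i : α // ¬ f i = none} = Nat.card {y : α // ¬ ∀ i, f i ≠ some y} := by
    refine Nat.card_congr (Equiv.ofBijective (fun i => ⟨(f i.1).get
      (Option.isSome_iff_ne_none.2 i.2), fun h => h i.1 (by simp)⟩) ⟨?_, ?_⟩)
    · rintro ⟨i, hi⟩ ⟨i', hi'⟩ h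
      obtain ⟨y, hy⟩ := Option.ne_none_iff_exists'.1 hi
      obtain ⟨y', hy'⟩ := Option.ne_none_iff_exists'.1 hi'
      simp only [hy, hy', Option.get_some, Subtype.mk.injEq] at h
      exact Subtype.ext (hf _ _ _ hy (h ▸ hy'))
    · rintro ⟨y, hy⟩
      simp only [not_forall, not_not] at hy
      obtain ⟨i, hi⟩ := hy
      exact ⟨⟨i, by simp [hi]⟩, by simp [hi]⟩
  change Nat.card {y : α // ∀ i, f i ≠ some y} = Nat.card {i : α // f i = none}
  simp only [Nat.card_eq_fintype_card, Fintype.card_subtype_compl] at h ⊢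
  have h1 := Fintype.card_subtype_le fun i => f i = none
  have h2 := Fintype.card_subtype_le fun y => ∀ i, f i ≠ some y
  omega

/-- Given both inside parts, the permutation amounts to two independent crossing bijections. With
`j` undefined indices on each side there are `j!` choices for each; with unequal numbers there are
none. -/
theorem card_perm_parts (hf : IsPartialInjection f) (hg : IsPartialInjection g) :
    Nat.card {w : Equiv.Perm (α ⊕ β) // leftPart w = f ∧ rightPart w = g} =
      if Nat.card (Undef f) = Nat.card (Undef g) then (Nat.card (Undef f)).factorial ^ 2 else 0 := by
  classical
  have hparts : ∀ w : Equiv.Perm (α ⊕ β), (leftPart w = f ∧ rightPart w = g) ↔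
      (∀ i y, f i = some y ↔ w (Sum.inl i) = Sum.inl y) ∧
        ∀ i y, g i = some y ↔ w (Sum.inr i) = Sum.inr y := by
    intro w
    constructor
    · rintro ⟨rfl, rfl⟩
      exact ⟨fun _ _ => leftPart_eq_some, fun _ _ => rightPart_eq_some⟩
    · rintro ⟨h1, h2⟩
      constructor <;> ext i y
      · rw [leftPart_eq_some, h1]
      · rw [rightPart_eq_some, h2]
  let F (p : (Undef f ≃ Unattained g) × (Undef g ≃ Unattained f)) :
      {w : Equiv.Perm (α ⊕ β) // leftPart w = f ∧ rightPart w = g} :=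
    ⟨Equiv.ofBijective _ (Finite.injective_iff_bijective.1 (glue_injective hf hg p.1 p.2)), by
      rw [hparts]
      simp only [Equiv.ofBijective_apply]
      constructor
      · intro i y
        constructor
        · exact glue_inl_some _ _
        · intro h
          rcases hi : f i with _ | z
          · have := glue_inl_none (fun i => (p.1 i).1) (fun i => (p.2 i).1) ⟨i, hi⟩
            rw [h] at this
            simp at this
          · rw [glue_inl_some _ _ hi] at h
            rw [Sum.inl_injective h]
      · intro i y
        constructor
        · exact glue_inr_some _ _
        · intro h
          rcases hi : g i with _ | z
          · have := glue_inr_none (fun i => (p.1 i).1) (fun i => (p.2 i).1) ⟨i, hi⟩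
            rw [h] at this
            simp at this
          · rw [glue_inr_some _ _ hi] at h
            rw [Sum.inr_injective h]⟩
  have hF : Function.Bijective F := by
    constructor
    · rintro ⟨a, b⟩ ⟨a', b'⟩ h
      have h : ∀ x, glue f g (fun i => (a i).1) (fun i => (b i).1) x =
          glue f g (fun i => (a' i).1) (fun i => (b' i).1) x := fun x =>
        congrArg (fun w : {w : Equiv.Perm (α ⊕ β) // leftPart w = f ∧ rightPart w = g} => w.1 x) h
      refine Prod.ext (Equiv.ext fun i => Subtype.ext ?_) (Equiv.ext fun i => Subtype.ext ?_)
      · have := h (Sum.inl i.1)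
        rw [glue_inl_none, glue_inl_none] at this
        exact Sum.inr_injective this
      · have := h (Sum.inr i.1)
        rw [glue_inr_none, glue_inr_none] at this
        exact Sum.inl_injective this
    · rintro ⟨w, hw⟩
      obtain ⟨h1, h2⟩ := (hparts w).1 hw
      obtain ⟨a, ha⟩ := exists_crossing_equiv w h1 h2
      obtain ⟨b, hb⟩ := exists_crossing_equiv' w h1 h2
      refine ⟨(a, b), Subtype.ext (Equiv.ext ?_)⟩
      change ∀ x, glue f g (fun i => (a i).1) (fun i => (b i).1) x = w x
      rintro (i | i)
      · rcases hi : f i with _ | z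
        · exact (glue_inl_none _ _ ⟨i, hi⟩).trans (ha ⟨i, hi⟩).symm
        · exact (glue_inl_some _ _ hi).trans ((h1 _ _).1 hi).symm
      · rcases hi : g i with _ | z
        · exact (glue_inr_none _ _ ⟨i, hi⟩).trans (hb ⟨i, hi⟩).symm
        · exact (glue_inr_some _ _ hi).trans ((h2 _ _).1 hi).symm
  rw [← Nat.card_congr (Equiv.ofBijective F hF), Nat.card_prod]
  have hf' := card_unattained hf
  have hg' := card_unattained hg
  split_ifs with h
  · simp only [Nat.card_eq_fintype_card] at *
    rw [Fintype.card_equiv (Fintype.equivOfCardEq (h.trans hg'.symm)),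
      Fintype.card_equiv (Fintype.equivOfCardEq (h.symm.trans hf'.symm)), ← h, sq]
  · have : IsEmpty (Undef f ≃ Unattained g) :=
      ⟨fun e => h ((Nat.card_congr e).trans hg')⟩
    rw [Nat.card_of_isEmpty, zero_mul]

end Gluing

/-! ### Rook placements and derangements with a given excedance set. -/

section IncreasingPartialInjections

/-- A strictly increasing partial injection of `Fin k`, that is, a placement of non-attacking rooks
on a staircase board. -/
def IsRookPlacement {k : ℕ} (f : Fin k → Option (Fin k)) : Prop :=
  (∀ i y, f i = some y → i < y) ∧ IsPartialInjection f

open Classical in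
/-- The finite set of rook placements. -/
def rookPlacements (k : ℕ) : Finset (Fin k → Option (Fin k)) := univ.filter IsRookPlacement

theorem mem_rookPlacements {k : ℕ} {f : Fin k → Option (Fin k)} :
    f ∈ rookPlacements k ↔ IsRookPlacement f := by
  simp [rookPlacements]

/-- Prepends an index, whose value is `o`. -/
def consPartial {k : ℕ} (f : Fin k → Option (Fin k)) (o : Option (Fin k)) :
    Fin (k + 1) → Option (Fin (k + 1)) :=
  Fin.cons (o.map Fin.succ) fun i => (f i).map Fin.succ

theorem card_undef_consPartial {k : ℕ} (f : Fin k → Option (Fin k)) (o : Option (Fin k)) :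
    Nat.card (Undef (consPartial f o)) = Nat.card (Undef f) + if o = none then 1 else 0 := by
  simp only [Nat.card_eq_fintype_card, Fintype.card_subtype]
  rw [Fin.card_filter_univ_succ]
  simp only [consPartial, Fin.cons_zero, Fin.cons_succ, Option.map_eq_none_iff]
  split_ifs <;> rfl

theorem isRookPlacement_consPartial {k : ℕ} {f : Fin k → Option (Fin k)} {o : Option (Fin k)} :
    IsRookPlacement (consPartial f o) ↔
      IsRookPlacement f ∧ ∀ y, o = some y → ∀ i, f i ≠ some y := by
  simp only [IsRookPlacement, IsPartialInjection, Fin.forall_fin_succ, consPartial, Fin.cons_zero,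
    Fin.cons_succ, Option.map_eq_some_iff, Fin.succ_inj, Fin.succ_lt_succ_iff]
  simp only [Fin.succ_ne_zero, and_false, exists_false, exists_eq_right, Fin.succ_pos]
  simp [(Fin.succ_ne_zero _).symm]
  grind

theorem consPartial_injective {k : ℕ} {f f' : Fin k → Option (Fin k)} {o o' : Option (Fin k)}
    (h : consPartial f o = consPartial f' o') : f = f' ∧ o = o' := by
  have hinj := Option.map_injective (Fin.succ_injective k)
  constructor
  · ext1 i
    have := congrFun h i.succ
    simp only [consPartial, Fin.cons_succ] at this
    exact hinj this
  · have := congrFun h 0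
    simp only [consPartial, Fin.cons_zero] at this
    exact hinj this

/-- Every value exceeds its index, hence is nonzero and a successor. -/
theorem exists_consPartial {k : ℕ} {h : Fin (k + 1) → Option (Fin (k + 1))}
    (hh : IsRookPlacement h) : ∃ f o, h = consPartial f o := by
  have key : ∀ i, ∃ o : Option (Fin k), h i = o.map Fin.succ := by
    intro i
    rcases hi : h i with _ | y
    · exact ⟨none, rfl⟩
    · obtain ⟨z, rfl⟩ := Fin.exists_succ_eq.2 ((Fin.zero_le i).trans_lt (hh.1 i y hi)).ne'
      exact ⟨some z, rfl⟩
  choose o ho using key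
  refine ⟨fun i => o i.succ, o 0, funext fun i => ?_⟩
  refine Fin.cases ?_ (fun i => ?_) i
  · simpa [consPartial] using ho 0
  · simpa [consPartial] using ho i.succ

/-- The new index 0 is either left undefined or sent to an unattained value, and there are as many
of these as undefined indices. The arbitrary weight `φ` records the distribution of the number of
undefined indices. -/
theorem sum_rookPlacements_succ (k : ℕ) (φ : ℕ → ℕ) :
    ∑ h ∈ rookPlacements (k + 1), φ (Nat.card (Undef h)) =
      ∑ f ∈ rookPlacements k, (φ (Nat.card (Undef f) + 1) +
        Nat.card (Undef f) * φ (Nat.card (Undef f))) := by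
  classical
  have h1 : ∀ f ∈ rookPlacements k, φ (Nat.card (Undef f) + 1) +
      Nat.card (Undef f) * φ (Nat.card (Undef f)) =
      ∑ o ∈ insertNone (univ.filter fun y => ∀ i, f i ≠ some y),
        φ (Nat.card (Undef (consPartial f o))) := by
    intro f hf
    rw [sum_insertNone]
    simp only [card_undef_consPartial, if_true, reduceCtorEq, if_false, add_zero, sum_const,
      smul_eq_mul]
    rw [← Fintype.card_subtype, ← Nat.card_eq_fintype_card,
      card_unattained (mem_rookPlacements.1 hf).2]
  rw [sum_congr rfl h1, sum_sigma']
  symm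
  refine sum_bij (fun p _ => consPartial p.1 p.2) ?_ ?_ ?_ fun _ _ => rfl
  · rintro ⟨f, o⟩ h
    simp only [mem_sigma, mem_rookPlacements, mem_insertNone, mem_filter, mem_univ, true_and,
      Option.mem_def] at h
    exact mem_rookPlacements.2 (isRookPlacement_consPartial.2 h)
  · rintro ⟨f, o⟩ _ ⟨f', o'⟩ _ h
    obtain ⟨rfl, rfl⟩ := consPartial_injective h
    rfl
  · intro h hh
    obtain ⟨f, o, rfl⟩ := exists_consPartial (mem_rookPlacements.1 hh)
    refine ⟨⟨f, o⟩, ?_, rfl⟩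
    simp only [mem_sigma, mem_rookPlacements, mem_insertNone, mem_filter, mem_univ, true_and,
      Option.mem_def]
    exact isRookPlacement_consPartial.1 (mem_rookPlacements.1 hh)

/-- The preceding recursion is that of the Stirling numbers, so `S(k, j)` placements have `j`
undefined indices. -/
theorem sum_rookPlacements {k N : ℕ} (hk : k < N) (φ : ℕ → ℕ) :
    ∑ f ∈ rookPlacements k, φ (Nat.card (Undef f)) =
      ∑ j ∈ range N, k.stirlingSecond j * φ j := by
  obtain ⟨M, rfl⟩ : ∃ M, N = M + 1 := ⟨N - 1, by omega⟩
  induction k generalizing φ with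
  | zero =>
    have h : rookPlacements 0 = univ := eq_univ_iff_forall.2 fun f =>
      mem_rookPlacements.2 ⟨fun i => i.elim0, fun i => i.elim0⟩
    rw [h, sum_range_succ', Fintype.sum_unique]
    simp
  | succ k ih =>
    have h1 : ∑ j ∈ range (M + 1), k.stirlingSecond j * φ (j + 1) =
        ∑ j ∈ range M, k.stirlingSecond j * φ (j + 1) := by
      rw [sum_range_succ, Nat.stirlingSecond_eq_zero_of_lt (by omega : k < M), zero_mul, add_zero]
    have h2 : ∑ j ∈ range (M + 1), k.stirlingSecond j * (j * φ j) =
        ∑ j ∈ range M, k.stirlingSecond (j + 1) * ((j + 1) * φ (j + 1)) := by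
      rw [sum_range_succ', zero_mul, mul_zero, add_zero]
    rw [sum_rookPlacements_succ, ih (fun j => φ (j + 1) + j * φ j) (by omega)]
    simp only [mul_add, sum_add_distrib]
    rw [h1, h2, sum_range_succ' _ M, Nat.stirlingSecond_succ_zero, zero_mul, add_zero,
      ← sum_add_distrib]
    refine sum_congr rfl fun j _ => ?_
    rw [Nat.stirlingSecond_succ_succ]
    ring

/-- The permutations of `Fin k ⊕ Fin m` that are increasing inside both summands. -/
def IsIncreasingInside {k m : ℕ} (w : Equiv.Perm (Fin k ⊕ Fin m)) : Prop :=
  (∀ i y, w (Sum.inl i) = Sum.inl y → i < y) ∧ ∀ i y, w (Sum.inr i) = Sum.inr y → i < y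

theorem isIncreasingInside_iff {k m : ℕ} {w : Equiv.Perm (Fin k ⊕ Fin m)} :
    IsIncreasingInside w ↔ IsRookPlacement (leftPart w) ∧ IsRookPlacement (rightPart w) := by
  simp only [IsIncreasingInside, IsRookPlacement, leftPart_eq_some, rightPart_eq_some,
    isPartialInjection_leftPart, isPartialInjection_rightPart, and_true]

theorem ncard_isIncreasingInside {k m N : ℕ} (hk : k < N) (hm : m < N) :
    {w : Equiv.Perm (Fin k ⊕ Fin m) | IsIncreasingInside w}.ncard =
      ∑ j ∈ range N, ordStirling j k * ordStirling j m := by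
  classical
  have h1 : {w : Equiv.Perm (Fin k ⊕ Fin m) | IsIncreasingInside w} =
      (univ.filter fun w => IsIncreasingInside w : Finset (Equiv.Perm (Fin k ⊕ Fin m))) := by
    ext; simp
  rw [h1, Set.ncard_coe_finset, card_eq_sum_card_fiberwise (f := fun w => (leftPart w, rightPart w))
    (t := rookPlacements k ×ˢ rookPlacements m), sum_product]
  · have h2 : ∀ f ∈ rookPlacements k, ∀ g ∈ rookPlacements m,
        #{w ∈ (univ.filter fun w => IsIncreasingInside w : Finset (Equiv.Perm (Fin k ⊕ Fin m))) |
          (leftPart w, rightPart w) = (f, g)} =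
        if Nat.card (Undef f) = Nat.card (Undef g) then (Nat.card (Undef f)).factorial ^ 2
          else 0 := by
      intro f hf g hg
      have hf := mem_rookPlacements.1 hf
      have hg := mem_rookPlacements.1 hg
      rw [← card_perm_parts hf.2 hg.2, Nat.card_eq_fintype_card, Fintype.card_subtype,
        filter_filter]
      congr 1
      refine filter_congr fun w _ => ?_
      rw [isIncreasingInside_iff, Prod.mk.injEq]
      constructor
      · exact fun h => h.2
      · rintro ⟨rfl, rfl⟩
        exact ⟨⟨hf, hg⟩, rfl, rfl⟩
    rw [sum_congr rfl fun f hf => sum_congr rfl fun g hg => h2 f hf g hg]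
    rw [sum_congr rfl fun f _ => sum_rookPlacements hm
      (fun j => if Nat.card (Undef f) = j then (Nat.card (Undef f)).factorial ^ 2 else 0),
      sum_rookPlacements hk (fun i => ∑ j ∈ range N,
        m.stirlingSecond j * if i = j then i.factorial ^ 2 else 0)]
    refine sum_congr rfl fun i hi => ?_
    simp only [mul_ite, mul_zero]
    rw [sum_ite_eq, if_pos hi, ordStirling, ordStirling]
    ring
  · intro w hw
    have hw : IsIncreasingInside w := by simpa using hw
    have := isIncreasingInside_iff.1 hw
    simpa [mem_rookPlacements] using this

/-- The condition is `w i > i` on the first `k` elements and `w i < i` on the last `m`. Reversing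
the order of the last `m` makes both conditions increasing inside their summand, and crossing values
satisfy them automatically. -/
theorem ncard_derangementsWithExcedanceSet (k m : ℕ) {N : ℕ} (hk : k < N) (hm : m < N) :
    (derangementsWithExcedanceSet (k + m) k).ncard =
      ∑ j ∈ range N, ordStirling j k * ordStirling j m := by
  rw [← ncard_isIncreasingInside hk hm]
  let e : Fin k ⊕ Fin m ≃ Fin (k + m) :=
    (Equiv.sumCongr (Equiv.refl _) Fin.revPerm).trans finSumFinEquiv
  have hl : ∀ i, (e (Sum.inl i) : ℕ) = i := by intro i; simp [e]
  have hr : ∀ i, (e (Sum.inr i) : ℕ) = k + (m - (i + 1)) := by intro i; simp [e]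
  have h : derangementsWithExcedanceSet (k + m) k =
      e.permCongr '' {w : Equiv.Perm (Fin k ⊕ Fin m) | IsIncreasingInside w} := by
    ext w
    obtain ⟨w, rfl⟩ := e.permCongr.surjective w
    rw [e.permCongr.injective.mem_set_image]
    simp only [derangementsWithExcedanceSet, excedanceSet, derangements, Set.mem_ofPred_eq,
      Finset.ext_iff, mem_filter, mem_univ, true_and, e.surjective.forall, Equiv.permCongr_apply,
      Equiv.symm_apply_apply, Sum.forall, IsIncreasingInside, Fin.lt_def, ne_eq, Fin.ext_iff, hl, hr]
    have hwl : ∀ i, (∃ y, w (Sum.inl i) = Sum.inl y) ∨ ∃ y, w (Sum.inl i) = Sum.inr y :=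
      fun i => by rcases w (Sum.inl i) with y | y <;> simp
    have hwr : ∀ i, (∃ y, w (Sum.inr i) = Sum.inl y) ∨ ∃ y, w (Sum.inr i) = Sum.inr y :=
      fun i => by rcases w (Sum.inr i) with y | y <;> simp
    constructor
    · rintro ⟨⟨h1, h2⟩, h3, h4⟩
      constructor
      · intro i y hy
        have := (h3 i).2 i.2
        rw [hy, hl] at this
        exact this
      · intro i y hy
        -- Not an excedance and not a fixed point means a strict descent, which the reversal turns
        -- into `i < y`.
        have h5 := h4 i
        have h6 := h2 i
        rw [hy, hr] at h5 h6
        omega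
    · rintro ⟨h1, h2⟩
      have h3 : ∀ i : Fin k, (i : ℕ) < e (w (Sum.inl i)) := by
        intro i
        rcases hwl i with ⟨y, hy⟩ | ⟨y, hy⟩
        · rw [hy, hl]
          exact h1 i y hy
        · rw [hy, hr]
          omega
      have h4 : ∀ i : Fin m, (e (w (Sum.inr i)) : ℕ) < k + (m - (i + 1)) := by
        intro i
        rcases hwr i with ⟨y, hy⟩ | ⟨y, hy⟩
        · rw [hy, hl]
          omega
        · have := h2 i y hy
          rw [hy, hr]
          omega
      exact ⟨⟨fun i => (h3 i).ne', fun i => (h4 i).ne⟩, fun i => iff_of_true (h3 i) i.2,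
        fun i => iff_of_false (h4 i).not_gt (by omega)⟩
  rw [h, Set.ncard_image_of_injective _ e.permCongr.injective]

end IncreasingPartialInjections

/-! ### A multiplicative cone of symmetric unimodal polynomials. -/

section Unimodality

/-- The cone generated by the polynomials `x^i + x^(i+1) + ⋯ + x^(n-i)` with `2 i ≤ n`. Its
elements are symmetric and unimodal with center of symmetry `n / 2`. -/
def unimodalCone (n : ℕ) : AddSubmonoid ℤ[X] :=
  AddSubmonoid.closure {p | ∃ i s : ℕ, 2 * i + s = n ∧ p = X ^ i * ∑ t ∈ range (s + 1), X ^ t}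

theorem X_pow_mul_geom_sum_mem {n i s : ℕ} (h : 2 * i + s = n) :
    X ^ i * ∑ t ∈ range (s + 1), (X : ℤ[X]) ^ t ∈ unimodalCone n :=
  AddSubmonoid.subset_closure ⟨i, s, h, rfl⟩

theorem X_pow_mul_mem {n i m : ℕ} (h : 2 * i + m = n) {p : ℤ[X]} (hp : p ∈ unimodalCone m) :
    X ^ i * p ∈ unimodalCone n := by
  induction hp using AddSubmonoid.closure_induction with
  | mem p hp =>
    obtain ⟨j, s, hs, rfl⟩ := hp
    rw [← mul_assoc, ← pow_add]
    exact X_pow_mul_geom_sum_mem (by omega)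
  | zero => rw [mul_zero]; exact zero_mem _
  | add p q _ _ hp hq => rw [mul_add]; exact add_mem hp hq

/-- Peels the longest centered run of ones off the product, leaving a shorter product shifted by
`X`. It is checked after multiplication by `(X - 1)^2`. -/
theorem geom_sum_mul_geom_sum (a b : ℕ) :
    (∑ t ∈ range (a + 2), (X : ℤ[X]) ^ t) * ∑ t ∈ range (b + 2), X ^ t =
      ∑ t ∈ range (a + b + 2 + 1), X ^ t +
        X * ((∑ t ∈ range (a + 1), X ^ t) * ∑ t ∈ range (b + 1), X ^ t) := by
  have hX : (X - 1 : ℤ[X]) ^ 2 ≠ 0 := pow_ne_zero _ (X_sub_C_ne_zero (1 : ℤ))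
  apply mul_right_cancel₀ hX
  have h := fun n => geom_sum_mul (X : ℤ[X]) n
  calc _ = ((∑ t ∈ range (a + 2), (X : ℤ[X]) ^ t) * (X - 1)) *
        ((∑ t ∈ range (b + 2), (X : ℤ[X]) ^ t) * (X - 1)) := by ring
    _ = ((∑ t ∈ range (a + b + 2 + 1), (X : ℤ[X]) ^ t) * (X - 1)) * (X - 1) +
        X * (((∑ t ∈ range (a + 1), (X : ℤ[X]) ^ t) * (X - 1)) *
          ((∑ t ∈ range (b + 1), (X : ℤ[X]) ^ t) * (X - 1))) := by
      simp only [h]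
      ring
    _ = _ := by ring

theorem geom_sum_mul_geom_sum_mem (a b : ℕ) :
    (∑ t ∈ range (a + 1), (X : ℤ[X]) ^ t) * ∑ t ∈ range (b + 1), X ^ t ∈ unimodalCone (a + b) := by
  induction a generalizing b with
  | zero => simpa using X_pow_mul_geom_sum_mem (n := 0 + b) (i := 0) (s := b) (by omega)
  | succ a ih =>
    cases b with
    | zero => simpa using X_pow_mul_geom_sum_mem (n := a + 1) (i := 0) (s := a + 1) (by omega)
    | succ b =>
      rw [geom_sum_mul_geom_sum]
      refine add_mem ?_ ?_
      · simpa using X_pow_mul_geom_sum_mem (n := a + 1 + (b + 1)) (i := 0) (s := a + b + 2)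
          (by omega)
      · simpa using X_pow_mul_mem (n := a + 1 + (b + 1)) (i := 1) (by omega) (ih b)

theorem mul_mem_unimodalCone {m n : ℕ} {p q : ℤ[X]} (hp : p ∈ unimodalCone m)
    (hq : q ∈ unimodalCone n) : p * q ∈ unimodalCone (m + n) := by
  induction hp using AddSubmonoid.closure_induction with
  | mem p hp =>
    obtain ⟨i, s, hs, rfl⟩ := hp
    induction hq using AddSubmonoid.closure_induction with
    | mem q hq =>
      obtain ⟨j, t, ht, rfl⟩ := hq
      rw [mul_mul_mul_comm, ← pow_add]
      exact X_pow_mul_mem (by omega) (geom_sum_mul_geom_sum_mem s t)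
    | zero => rw [mul_zero]; exact zero_mem _
    | add p q _ _ hp hq => rw [mul_add]; exact add_mem hp hq
  | zero => rw [zero_mul]; exact zero_mem _
  | add p q _ _ hp hq => rw [add_mul]; exact add_mem hp hq

theorem one_add_X_mem : (1 + X : ℤ[X]) ∈ unimodalCone 1 := by
  simpa [sum_range_succ] using X_pow_mul_geom_sum_mem (n := 1) (i := 0) (s := 1) rfl

/-- Multiplying the full geometric sum by `1 + X` gives the next one plus `X + ⋯ + X^m`, which is
again in the cone. -/
theorem one_add_X_pow_sub_geom_sum_mem (m : ℕ) :
    (1 + X : ℤ[X]) ^ m - ∑ t ∈ range (m + 1), X ^ t ∈ unimodalCone m := by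
  induction m with
  | zero => simp
  | succ m ih =>
    have h1 := mul_mem_unimodalCone ih one_add_X_mem
    have h2 : (1 + X : ℤ[X]) ^ (m + 1) - ∑ t ∈ range (m + 1 + 1), X ^ t =
        ((1 + X) ^ m - ∑ t ∈ range (m + 1), X ^ t) * (1 + X) + X * ∑ t ∈ range m, X ^ t := by
      have h3 := geom_sum_succ (x := (X : ℤ[X])) (n := m + 1)
      have h4 := geom_sum_succ (x := (X : ℤ[X])) (n := m)
      linear_combination (-1) * h3 + h4
    rw [h2]
    refine add_mem h1 ?_
    cases m with
    | zero => simp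
    | succ m => simpa using X_pow_mul_geom_sum_mem (n := m + 1 + 1) (i := 1) (s := m) (by omega)

theorem one_add_X_pow_sub_mem {m : ℕ} (hm : 1 ≤ m) :
    (1 + X : ℤ[X]) ^ m - 1 - X ^ m ∈ unimodalCone m := by
  obtain ⟨m, rfl⟩ := Nat.exists_eq_add_of_le' hm
  -- Subtracting only the two end terms equals subtracting the full geometric sum and adding back
  -- its interior.
  have h : (1 + X : ℤ[X]) ^ (m + 1) - 1 - X ^ (m + 1) =
      ((1 + X) ^ (m + 1) - ∑ t ∈ range (m + 1 + 1), X ^ t) + X * ∑ t ∈ range m, X ^ t := by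
    rw [sum_range_succ]
    have h4 := geom_sum_succ (x := (X : ℤ[X])) (n := m)
    linear_combination h4
  rw [h]
  refine add_mem (one_add_X_pow_sub_geom_sum_mem _) ?_
  cases m with
  | zero => simp
  | succ m => simpa using X_pow_mul_geom_sum_mem (n := m + 1 + 1) (i := 1) (s := m) (by omega)

theorem ellA_zero : ellA 0 = 1 := by
  rw [ellA_eq_sum]
  simp [compSeq]

theorem ellA_mem_unimodalCone (n : ℕ) : ellA n ∈ unimodalCone n := by
  induction n using Nat.strong_induction_on with
  | _ n ih =>
    rcases Nat.eq_zero_or_pos n with rfl | hn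
    · rw [ellA_zero]
      simpa using X_pow_mul_geom_sum_mem (n := 0) (i := 0) (s := 0) rfl
    · rw [ellA_recurrence hn]
      refine sum_mem fun k hk => ?_
      have hk := mem_range.1 hk
      rw [mul_assoc, ← nsmul_eq_mul]
      refine nsmul_mem ?_ _
      have := mul_mem_unimodalCone (ih k hk) (one_add_X_pow_sub_mem (m := n - k) (by omega))
      rwa [Nat.add_sub_cancel' hk.le] at this

theorem coeff_le_coeff_of_mem_unimodalCone {n : ℕ} {p : ℤ[X]} (hp : p ∈ unimodalCone n) (i : ℕ) :
    (2 * i + 1 ≤ n → p.coeff i ≤ p.coeff (i + 1)) ∧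
      (n ≤ 2 * i + 1 → p.coeff (i + 1) ≤ p.coeff i) := by
  induction hp using AddSubmonoid.closure_induction with
  | mem p hp =>
    obtain ⟨j, s, hs, rfl⟩ := hp
    simp only [coeff_X_pow_mul', finsetSum_coeff, coeff_X_pow, sum_ite_eq, mem_range]
    constructor <;> intro h <;> split_ifs <;> omega
  | zero => simp
  | add p q _ _ hp hq =>
    simp only [coeff_add]
    exact ⟨fun h => add_le_add (hp.1 h) (hq.1 h), fun h => add_le_add (hp.2 h) (hq.2 h)⟩

theorem isUnimodal_of_mem_unimodalCone {n : ℕ} {p : ℤ[X]} (hp : p ∈ unimodalCone n) :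
    IsUnimodal p := by
  have h := coeff_le_coeff_of_mem_unimodalCone hp
  have hmono : MonotoneOn p.coeff (Set.Icc 0 (n / 2)) := by
    intro i _ j hj hij
    have hj := hj.2
    induction j, hij using Nat.le_induction with
    | base => exact le_rfl
    | succ j _ ih => exact (ih ⟨Nat.zero_le _, by omega⟩ (by omega)).trans ((h j).1 (by omega))
  have hanti : AntitoneOn p.coeff (Set.Ici (n / 2)) := by
    intro i hi j _ hij
    have hi : n / 2 ≤ i := hi
    induction j, hij using Nat.le_induction with
    | base => exact le_rfl
    | succ j hj ih => exact ((h j).2 (by omega)).trans (ih (hi.trans hj))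
  -- The definition requires the peak not to exceed the degree. If the degree is below `n / 2`, the
  -- decreasing range is a single point.
  refine ⟨min (n / 2) p.natDegree, min_le_right _ _,
    hmono.mono (Set.Icc_subset_Icc_right (min_le_left _ _)), ?_⟩
  rcases le_total (n / 2) p.natDegree with hd | hd
  · rw [min_eq_left hd]
    exact hanti.mono Set.Icc_subset_Ici_self
  · rw [min_eq_right hd, Set.Icc_self]
    exact Set.subsingleton_singleton.antitoneOn _

end Unimodality

end

end Antiprism

theorem mainTheorem8 :
    (∀ n : ℕ, 1 ≤ n →
      Antiprism.ellA n = ∑ k ∈ Finset.range n,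
        (n.choose k : ℤ[X]) * Antiprism.ellA k * ((1 + X) ^ (n - k) - 1 - X ^ (n - k))) ∧
    (∀ n : ℕ, Antiprism.IsUnimodal (Antiprism.ellA n)) ∧
    (∀ n k : ℕ,
      (Antiprism.ellA n).coeff k = ((Antiprism.properMultiPointed n k).ncard : ℤ) ∧
      (Antiprism.ellA n).coeff k = ((Antiprism.coloredPartitions n k).ncard : ℤ) ∧
      (Antiprism.ellA n).coeff k = ((Antiprism.evenPartitions n k).ncard : ℤ) ∧
      (Antiprism.ellA n).coeff k =
        (n.choose k : ℤ) * ((Antiprism.derangementsWithExcedanceSet n k).ncard : ℤ) ∧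
      (Antiprism.ellA n).coeff k =
        ((n.choose k * ∑ j ∈ Finset.range (n + 1),
          j.factorial ^ 2 * k.stirlingSecond j * (n - k).stirlingSecond j : ℕ) : ℤ) ∧
      (1 ≤ n → (Antiprism.ellA n).coeff k =
        ((n.choose k * ∑ j ∈ Finset.Icc 1 n,
          j.factorial ^ 2 * k.stirlingSecond j * (n - k).stirlingSecond j : ℕ) : ℤ))) := by
  refine ⟨fun n hn => Antiprism.ellA_recurrence hn,
    fun n => Antiprism.isUnimodal_of_mem_unimodalCone (Antiprism.ellA_mem_unimodalCone n),
    fun n k => ?_⟩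
  have hpairs : (Antiprism.ellA n).coeff k = ((Antiprism.partitionPairs (Fin n) k).ncard : ℤ) := by
    rw [Antiprism.coeff_ellA, Antiprism.ncard_partitionPairs, Fintype.card_fin]
  have hstirling : (Antiprism.ellA n).coeff k = ((n.choose k * ∑ j ∈ Finset.range (n + 1),
      j.factorial ^ 2 * k.stirlingSecond j * (n - k).stirlingSecond j : ℕ) : ℤ) := by
    rw [Antiprism.coeff_ellA]
    congr 2
    refine Finset.sum_congr rfl fun j _ => ?_
    rw [Antiprism.ordStirling, Antiprism.ordStirling]
    ring
  refine ⟨?_, ?_, ?_, ?_, hstirling, fun hn => ?_⟩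
  · rw [Antiprism.ncard_properMultiPointed, Antiprism.ncard_coloredPartitions, hpairs]
  · rw [Antiprism.ncard_coloredPartitions, hpairs]
  · rw [Antiprism.ncard_evenPartitions, hpairs]
  · rw [Antiprism.coeff_ellA]
    rcases le_or_gt k n with hk | hk
    · obtain ⟨m, rfl⟩ := Nat.exists_eq_add_of_le hk
      rw [Antiprism.ncard_derangementsWithExcedanceSet k m (N := k + m + 1) (by omega) (by omega),
        Nat.add_sub_cancel_left]
      push_cast
      rfl
    · simp [Nat.choose_eq_zero_of_lt hk]
  · rw [hstirling, Finset.range_eq_Ico, Finset.sum_eq_sum_Ico_succ_bot (Nat.succ_pos n)]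
    -- The term `j = 0` is nonzero only if `k` and `n - k` both vanish, which `n ≥ 1` excludes.
    have h0 : k.stirlingSecond 0 * (n - k).stirlingSecond 0 = 0 := by
      rcases k with _ | k
      · obtain ⟨n, rfl⟩ := Nat.exists_eq_add_of_le' hn
        simp
      · simp
    rw [mul_assoc, h0, mul_zero, zero_add]
    rfl
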